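/- **Theorem (Föllmer exit measure).** Let $E$ be a Polish space, let $\triangle$ be an isolated cemetery state adjoined to $E$, and fix $x_*\in E$. Let $\Omega$ be the space of all paths $\omega:\mathbb{R}_+\to E\cup\{\triangle\}$ which start at $x_*$, are càdlàg on $[0,\zeta(\omega))$ and constant on $[\zeta(\omega),\infty)$, where $\zeta(\omega):=\inf\{t\ge 0:\omega_t=\triangle\}\in(0,\infty]$ is the lifetime of $\omega$. Let $B_t(\omega)=\omega_t$, $\mathcal{F}_t=\sigma(B_s,\,s\le t)$, $\mathcal{F}=\sigma(B_s,\,s\ge 0)$, and let $\mathbb{F}_+=(\mathcal{F}_{t+})_{t\ge0}$ be the (uncompleted) smallest right-continuous filtration containing $(\mathcal{F}_t)_{t\ge 0}$. For probabilities $P,Q$ on $(\Omega,\mathcal{F})$ write $Q\sim_\zeta P$ if, for every $t\in\mathbb{R}_+$ and $A\in\mathcal{F}_t$, $Q(A\cap\{t<\zeta\})=0$ if and only if $P(A\cap\{t<\zeta\})=0$. When $\zeta=\infty$ $P$-a.s., an $\mathbb{F}_+$-adapted, $P$-a.s. nonnegative and càdlàg process $Y$ is called a prior-to-$\zeta$ density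 process of $Q$ with respect to $P$ if $$Q(A\cap\{\tau<\zeta\})=E^P\big[Y_\tau\mathbf 1_A\mathbf 1_{\{\tau<\zeta\}}\big]\quad\text{for all } \mathbb{F}_+\text{-stopping times }\tau \text{ and } A\in\mathcal{F}_{\tau+}.$$ The lifetime $\zeta$ is foretellable under $Q$ if there are $\mathbb{F}_+$-stopping times $(\tau_n)_{n\in\mathbb{N}}$ such that $Q\{\tau_n<\zeta\}=1$ for all $n$ and $Q\{\lim_n\tau_n=\zeta\}=1$. Let $P$ be a probability on $(\Omega,\mathcal{F})$ with $\zeta=\infty$ $P$-a.s., and let $Y$ be an $(\mathbb{F}_+,P)$-supermartingale which $P$-a.s. has strictly positive càdlàg paths and satisfies $E^P[Y_0]=1$. Then there exists a probability $Q$ on $(\Omega,\mathcal{F})$ such that $Q\sim_\zeta P$ and $Y$ is a prior-to-$\zeta$ density process of $Q$ with respect to $P$. Furthermore, if $Y$ is an $(\mathbb{F}_+,P)$-local martingale, then $\zeta$ is foretellable under $Q$. -/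

import Mathlib

open MeasureTheory ProbabilityTheory Filter Topology
open scoped NNReal ENNReal

noncomputable section

namespace ExitMeasure

/-! ### The path space with an isolated cemetery state -/

/-- The state space `E` with an isolated cemetery state adjoined: the sum carries the topology
in which the extra point is isolated, and (for `E` Borel) its Borel σ-field. -/
abbrev WithCemetery (E : Type*) : Type _ := E ⊕ Unit

/-- The cemetery state. -/
def cemetery {E : Type*} : WithCemetery E := Sum.inr ()

/-- The lifetime `inf {t ≥ 0 : w t = cemetery}` of a path, with `inf ∅ = ∞`. -/
def pathLifetime {E : Type*} (w : ℝ≥0 → WithCemetery E) : WithTop ℝ≥0 :=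
  ⨅ (t : ℝ≥0) (_ : w t = cemetery), (t : WithTop ℝ≥0)

/-- The set `Ω` of paths which start at `x₀ ∈ E`, are càdlàg on `[0, lifetime)` and constant on
`[lifetime, ∞)`. (No left limit is required at the lifetime itself.) -/
structure PathSpace (E : Type*) [TopologicalSpace E] (x₀ : E) where
  toFun : ℝ≥0 → WithCemetery E
  start : toFun 0 = Sum.inl x₀
  right_continuous : ∀ t : ℝ≥0, (t : WithTop ℝ≥0) < pathLifetime toFun →
    ContinuousWithinAt toFun (Set.Ici t) t
  left_limit : ∀ t : ℝ≥0, (t : WithTop ℝ≥0) < pathLifetime toFun →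
    ∃ l : WithCemetery E, Tendsto toFun (𝓝[<] t) (𝓝 l)
  constant : ∀ s t : ℝ≥0, pathLifetime toFun ≤ (s : WithTop ℝ≥0) →
    pathLifetime toFun ≤ (t : WithTop ℝ≥0) → toFun s = toFun t

section

variable {E : Type*} [TopologicalSpace E] {x₀ : E}

/-- The canonical process `B_t(ω) = ω_t`. -/
def canonicalProcess (t : ℝ≥0) (ω : PathSpace E x₀) : WithCemetery E := ω.toFun t

/-- The lifetime `ζ` of a path. -/
def lifetime (ω : PathSpace E x₀) : WithTop ℝ≥0 := pathLifetime ω.toFun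

/-- The σ-field `𝓕 = σ(B_s, s ≥ 0)`. -/
instance instMeasurableSpacePathSpace [MeasurableSpace E] : MeasurableSpace (PathSpace E x₀) :=
  ⨆ s : ℝ≥0, MeasurableSpace.comap (canonicalProcess s) inferInstance

/-- The natural filtration `𝓕_t = σ(B_s, s ≤ t)` of the canonical process. -/
def naturalFiltration (E : Type*) [TopologicalSpace E] [MeasurableSpace E] (x₀ : E) :
    Filtration ℝ≥0 (instMeasurableSpacePathSpace (E := E) (x₀ := x₀)) where
  seq t := ⨆ (s : ℝ≥0) (_ : s ≤ t), MeasurableSpace.comap (canonicalProcess s) inferInstance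
  mono' _ _ h := iSup₂_le fun s hs ↦ le_iSup₂_of_le s (hs.trans h) le_rfl
  le' _ := iSup₂_le fun s _ ↦
    le_iSup (fun s : ℝ≥0 ↦ MeasurableSpace.comap (canonicalProcess (E := E) (x₀ := x₀) s)
      inferInstance) s

/-- The smallest right-continuous filtration `𝔽₊ = (𝓕_{t+})` containing the natural one.
It is not completed. -/
def filtrationPlus (E : Type*) [TopologicalSpace E] [MeasurableSpace E] (x₀ : E) :
    Filtration ℝ≥0 (instMeasurableSpacePathSpace (E := E) (x₀ := x₀)) :=
  (naturalFiltration E x₀).rightCont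

variable [MeasurableSpace E]

/-! ### Prior-to-lifetime relations between measures -/

/-- `Q ≪_ζ P`: for every `t`, `Q ≪ P` on `({t < ζ}, 𝓕_t ∩ {t < ζ})`. -/
def PriorAbsolutelyContinuous (Q P : Measure (PathSpace E x₀)) : Prop :=
  ∀ (t : ℝ≥0) (A : Set (PathSpace E x₀)), MeasurableSet[naturalFiltration E x₀ t] A →
    P (A ∩ {ω | (t : WithTop ℝ≥0) < lifetime ω}) = 0 →
    Q (A ∩ {ω | (t : WithTop ℝ≥0) < lifetime ω}) = 0

/-- `Q ∼_ζ P`. -/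
def PriorEquivalent (Q P : Measure (PathSpace E x₀)) : Prop :=
  PriorAbsolutelyContinuous Q P ∧ PriorAbsolutelyContinuous P Q

/-- A real path on `[0, ∞)` is càdlàg. -/
def IsCadlagPath (y : ℝ≥0 → ℝ) : Prop :=
  ∀ t : ℝ≥0, ContinuousWithinAt y (Set.Ici t) t ∧ ∃ l : ℝ, Tendsto y (𝓝[<] t) (𝓝 l)

/-- `Y` is the prior-to-`ζ` density process of `Q` with respect to `P`: it is `𝔽₊`-adapted,
`P`-a.s. nonnegative and càdlàg, and `Q(A ∩ {τ < ζ}) = E^P[Y_τ 1_A 1_{τ < ζ}]` for every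
`𝔽₊`-stopping time `τ` and every `A ∈ 𝓕_{τ+}`. -/
def IsPriorDensityProcess (Y : ℝ≥0 → PathSpace E x₀ → ℝ) (Q P : Measure (PathSpace E x₀)) :
    Prop :=
  StronglyAdapted (filtrationPlus E x₀) Y ∧
  (∀ᵐ ω ∂P, (∀ t, 0 ≤ Y t ω) ∧ IsCadlagPath fun t ↦ Y t ω) ∧
  ∀ (τ : PathSpace E x₀ → WithTop ℝ≥0) (hτ : IsStoppingTime (filtrationPlus E x₀) τ)
    (A : Set (PathSpace E x₀)), MeasurableSet[hτ.measurableSpace] A →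
    Q (A ∩ {ω | τ ω < lifetime ω}) =
      ∫⁻ ω in A ∩ {ω | τ ω < lifetime ω}, ENNReal.ofReal (stoppedValue Y τ ω) ∂P

/-- `Y` is an `(𝔽₊, P)`-local martingale: it is adapted, `P`-a.s. càdlàg, and there are
`𝔽₊`-stopping times `τ_n`, `P`-a.s. nondecreasing to `∞`, such that each stopped process
`(Y_{t ∧ τ_n} 1_{τ_n > 0})_t` is integrable and has the martingale property. (As the filtration is
not completed and `Y` is càdlàg only almost surely, strict adaptedness of the stopped process is
not demanded; it is automatic if all paths are right-continuous.) -/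
def IsLocalMartingale (Y : ℝ≥0 → PathSpace E x₀ → ℝ) (P : Measure (PathSpace E x₀)) : Prop :=
  StronglyAdapted (filtrationPlus E x₀) Y ∧
  (∀ᵐ ω ∂P, IsCadlagPath fun t ↦ Y t ω) ∧
  Locally (fun X ↦ (∀ t, Integrable (X t) P) ∧
    ∀ s t, s ≤ t → P[X t | filtrationPlus E x₀ s] =ᵐ[P] X s) (filtrationPlus E x₀) Y P

/-- `ζ` is foretellable under `Q`: there are `𝔽₊`-stopping times `τ_n` with `Q(τ_n < ζ) = 1` for
all `n` and `Q(lim τ_n = ζ) = 1`. -/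
def LifetimeForetellable (Q : Measure (PathSpace E x₀)) : Prop :=
  ∃ τ : ℕ → PathSpace E x₀ → WithTop ℝ≥0,
    (∀ n, IsStoppingTime (filtrationPlus E x₀) (τ n)) ∧
    (∀ n, ∀ᵐ ω ∂Q, τ n ω < lifetime ω) ∧
    ∀ᵐ ω ∂Q, Tendsto (fun n ↦ τ n ω) atTop (𝓝 (lifetime ω))

end

end ExitMeasure

end

/-!
The measure `Q` is determined on `{t < ζ}` by `Q (A ∩ {t < ζ}) = E^P[Y_t 1_A]` for `A ∈ 𝓕_{t+}`.
The measures `m t = Y_t · P` on the right-hand side have total mass at most one and decrease with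
`t` on events of the past, by the supermartingale property; the mass which is lost is the mass of
the paths that `Q` kills. The proof has four parts.

*A law on the dyadic times.* For the dyadic grid of mesh `2⁻ⁿ` on `[0, 2ⁿ]` there is an explicit
law of a path which is killed right after a grid point: `m t - m t'`, restricted to the past of
`t`, governs the paths killed between the successive grid points `t < t'` (`gridLaw`). These laws
are consistent (`IsSurvivalFamily.gridLaw_succ`), so Kolmogorov's extension theorem
(`exists_measure_map_frestrictLe`) gives a law for the values at all dyadic times, under which
survival up to a dyadic time is governed by `m` (`IsSurvivalFamily.exists_law`).

*Regularity of paths.* Whether values at dyadic times are those of a path of `Ω` is decided by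
finiteness of oscillations up to each dyadic time at which the path is alive (`RegularValues`).
This is a measurable condition on the values up to that time, and there the law is `m`, which is
carried by paths. Hence almost all values are regular, and `Q` is the image of the law under the
map `toPath` that takes right limits. The passage from dyadic times to all times, and from `𝓕_t` to
`𝓕_{t+}`, uses that `m` is right-continuous: one inequality is Fatou's lemma, the other the
supermartingale property (`tendsto_densityFamily`).

*Stopping times.* The density formula at a stopping time `τ` follows from the formula at the grid
points above `τ`. Fatou's lemma gives one inequality (`lintegral_stoppedValue_le`), and the reverse
Fatou lemma the other on the event that `Y` is bounded right after `τ` (`measure_boundedAfter_le`).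
Since the filtration is not completed and `Y` is càdlàg only `P`-almost surely, it has to be shown
that `Q` does not see the exceptional event on `{τ < ζ}`: before a dyadic time `s` it can be
enlarged to a `P`-null event of `𝓕_{s+}`, which is `Q`-null on `{s < ζ}`.

*Foretellability.* If the times `σ n` localize `Y`, then `E^P[Y_{n ∧ σ n}] = E^P[Y_0] = 1`, so the
density formula gives `Q (n ∧ σ n < ζ) = 1`. The event that `σ n < s` for infinitely many `n` is a
`P`-null event of `𝓕_{s+}`, so it is `Q`-null on `{s < ζ}`, and `n ∧ σ n` converges to `ζ` under
`Q` (`lifetimeForetellable_of_isLocalMartingale`).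
-/

noncomputable section

namespace ExitMeasure

/-! ### Extension of consistent laws on initial segments -/

/-- Kolmogorov's extension theorem for sequences of standard Borel spaces: the law on the first
`n + 2` coordinates is disintegrated over the first `n + 1`, and the resulting kernels are
composed by the theorem of Ionescu-Tulcea. -/
theorem exists_measure_map_frestrictLe {X : ℕ → Type*} [∀ n, MeasurableSpace (X n)]
    [∀ n, StandardBorelSpace (X n)] [∀ n, Nonempty (X n)]
    (ν : ℕ → Measure (∀ i, X i)) [∀ n, IsProbabilityMeasure (ν n)]
    (h : ∀ n, (ν (n + 1)).map (Preorder.frestrictLe n) = (ν n).map (Preorder.frestrictLe n)) :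
    ∃ μ : Measure (∀ i, X i), IsProbabilityMeasure μ ∧
      ∀ n, μ.map (Preorder.frestrictLe n) = (ν n).map (Preorder.frestrictLe n) := by
  let κ : (n : ℕ) → Kernel (∀ i : Finset.Iic n, X i) (X (n + 1)) := fun n ↦
    condDistrib (fun x : ∀ i, X i ↦ x (n + 1)) (Preorder.frestrictLe n) (ν (n + 1))
  have : IsProbabilityMeasure ((ν 0).map fun x : ∀ i, X i ↦ x 0) :=
    Measure.isProbabilityMeasure_map (measurable_pi_apply 0).aemeasurable
  refine ⟨Kernel.trajMeasure ((ν 0).map fun x ↦ x 0) κ, inferInstance, fun n ↦ ?_⟩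
  induction n with
  | zero =>
    have hcomp : Preorder.frestrictLe (π := X) 0 =
        (MeasurableEquiv.piUnique (fun i : Finset.Iic 0 ↦ X i)).symm ∘ fun x ↦ x 0 := by
      funext x i
      obtain ⟨i, hi⟩ := i
      obtain rfl : i = 0 := by simpa using hi
      rfl
    rw [Kernel.trajMeasure, Measure.map_comp _ _ (by fun_prop), Kernel.traj_map_frestrictLe,
      Kernel.partialTraj_self, Measure.id_comp, hcomp]
    exact Measure.map_map (MeasurableEquiv.measurable _) (measurable_pi_apply 0)
  | succ n ih =>
    let e : (∀ i : Finset.Iic n, X i) × X (n + 1) → ∀ i : Finset.Iic (n + 1), X i := fun z ↦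
      IicProdIoc n (n + 1) (z.1, MeasurableEquiv.piSingleton n z.2)
    have he : Measurable e := by fun_prop
    have hcomp : Preorder.frestrictLe (π := X) (n + 1) =
        e ∘ fun x ↦ (Preorder.frestrictLe n x, x (n + 1)) := by
      funext x i
      obtain ⟨i, hi⟩ := i
      have hi' : i ≤ n + 1 := by simpa using hi
      rcases Nat.lt_or_ge n i with h' | h'
      · obtain rfl : i = n + 1 := by omega
        simp [e, IicProdIoc_def, MeasurableEquiv.piSingleton]
      · simp [e, IicProdIoc_def, h']
    rw [hcomp, ← Measure.map_map he (by fun_prop),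
      ← Kernel.map_frestrictLe_trajMeasure_compProd_eq_map_trajMeasure, ih, ← h n,
      compProd_map_condDistrib (measurable_pi_apply (n + 1)).aemeasurable,
      Measure.map_map he (by fun_prop)]

/-! ### Paths and lifetimes -/

instance borelSpace_sum {α β : Type*} [TopologicalSpace α] [MeasurableSpace α] [BorelSpace α]
    [TopologicalSpace β] [MeasurableSpace β] [BorelSpace β] : BorelSpace (α ⊕ β) := by
  refine ⟨le_antisymm (fun s hs ↦ ?_) (MeasurableSpace.generateFrom_le fun s hs ↦ ?_)⟩
  · have h := measurableSet_sum_iff.1 hs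
    borelize (α ⊕ β)
    have hl := (Topology.IsOpenEmbedding.inl (X := α) (Y := β)).measurableEmbedding
    have hr := (Topology.IsOpenEmbedding.inr (X := α) (Y := β)).measurableEmbedding
    have := (hl.measurableSet_image' h.1).union (hr.measurableSet_image' h.2)
    rwa [Set.image_preimage_inl_union_image_preimage_inr] at this
  · have h := isOpen_sum_iff.1 hs
    exact measurableSet_sum_iff.2 ⟨h.1.measurableSet, h.2.measurableSet⟩

lemma inl_ne_cemetery {E : Type*} (x : E) : (Sum.inl x : WithCemetery E) ≠ cemetery :=
  Sum.inl_ne_inr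

section

variable {E : Type*} [TopologicalSpace E] {x₀ : E}

lemma isOpen_cemetery : IsOpen ({cemetery} : Set (WithCemetery E)) := by
  have := isOpenMap_inr (X := E) _ (isOpen_univ (X := Unit))
  rwa [Set.image_univ, Set.range_unique] at this

/-- The lifetime is attained: a path is alive at `t` exactly if `t` precedes its lifetime. -/
lemma lt_lifetime_iff (ω : PathSpace E x₀) (t : ℝ≥0) :
    (t : WithTop ℝ≥0) < lifetime ω ↔ ω.toFun t ≠ cemetery := by
  constructor
  · intro h hc
    exact absurd h (not_lt.2 (iInf₂_le t hc))
  · intro h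
    by_contra hlt
    have hle : pathLifetime ω.toFun ≤ t := not_lt.1 hlt
    have h2 : pathLifetime ω.toFun < ⊤ := lt_of_le_of_lt hle (WithTop.coe_lt_top t)
    obtain ⟨s, hs⟩ := iInf_lt_iff.1 h2
    obtain ⟨hs, -⟩ := iInf_lt_iff.1 hs
    exact h ((ω.constant t s hle (iInf₂_le s hs)).trans hs)

lemma toFun_eq_cemetery_of_le {ω : PathSpace E x₀} {s t : ℝ≥0} (hst : s ≤ t)
    (hs : ω.toFun s = cemetery) : ω.toFun t = cemetery := by
  by_contra h
  have := (lt_lifetime_iff ω t).2 h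
  exact (lt_lifetime_iff ω s).1 (lt_of_le_of_lt (WithTop.coe_le_coe.2 hst) this) hs

lemma toFun_ne_cemetery_of_lifetime_eq_top {ω : PathSpace E x₀} (h : lifetime ω = ⊤) (t : ℝ≥0) :
    ω.toFun t ≠ cemetery :=
  (lt_lifetime_iff ω t).1 (h ▸ WithTop.coe_lt_top t)

lemma tendsto_toFun_nhdsGT (ω : PathSpace E x₀) (t : ℝ≥0) :
    Tendsto ω.toFun (𝓝[>] t) (𝓝 (ω.toFun t)) := by
  by_cases h : (t : WithTop ℝ≥0) < lifetime ω
  · exact (ω.right_continuous t h).mono_left (nhdsWithin_mono _ Set.Ioi_subset_Ici_self)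
  · have hc : ω.toFun t = cemetery := by
      by_contra hc
      exact h ((lt_lifetime_iff ω t).2 hc)
    refine tendsto_const_nhds.congr' ?_
    filter_upwards [self_mem_nhdsWithin] with s hs
    rw [hc, toFun_eq_cemetery_of_le (le_of_lt hs) hc]

lemma PathSpace.ext' {ω ω' : PathSpace E x₀} (h : ω.toFun = ω'.toFun) : ω = ω' := by
  cases ω; cases ω'; cases h; rfl

/-- The path which stays at `x₀` for ever. -/
def constPath (E : Type*) [TopologicalSpace E] (x₀ : E) : PathSpace E x₀ where
  toFun _ := Sum.inl x₀
  start := rfl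
  right_continuous _ _ := continuousWithinAt_const
  left_limit _ _ := ⟨_, tendsto_const_nhds⟩
  constant _ _ _ _ := rfl

/-! ### A dense sequence of times -/

/-- An enumeration (with repetitions) of the dyadic rationals of `[0, ∞)`. -/
def dyadicTime (i : ℕ) : ℝ≥0 := (Nat.unpair i).1 / 2 ^ (Nat.unpair i).2

lemma exists_dyadicTime_eq (k n : ℕ) : ∃ i, dyadicTime i = k / 2 ^ n :=
  ⟨Nat.pair k n, by simp [dyadicTime]⟩

lemma exists_dyadicTime_between {a b : ℝ≥0} (h : a < b) :
    ∃ i, a < dyadicTime i ∧ dyadicTime i < b := by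
  obtain ⟨n, hn⟩ := exists_pow_lt_of_lt_one (tsub_pos_of_lt h) (show (2⁻¹ : ℝ≥0) < 1 from
    NNReal.inv_lt_one_iff (by norm_num) |>.2 (by norm_num))
  have h2 : (0 : ℝ≥0) < 2 ^ n := by positivity
  obtain ⟨i, hi⟩ := exists_dyadicTime_eq (⌊a * 2 ^ n⌋₊ + 1) n
  refine ⟨i, ?_, ?_⟩
  · rw [hi, lt_div_iff₀ h2]
    exact_mod_cast Nat.lt_floor_add_one (a * 2 ^ n)
  · rw [hi]
    calc ((⌊a * 2 ^ n⌋₊ + 1 : ℕ) : ℝ≥0) / 2 ^ n ≤ (a * 2 ^ n + 1) / 2 ^ n := by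
          gcongr
          push_cast
          gcongr
          exact Nat.floor_le (by positivity)
      _ = a + 2⁻¹ ^ n := by rw [inv_pow, add_div, mul_div_cancel_right₀ _ h2.ne', one_div]
      _ < a + (b - a) := by gcongr
      _ = b := add_tsub_cancel_of_le h.le

/-- Indices of dyadic times which decrease strictly to `t`. -/
def rightFilter (t : ℝ≥0) : Filter ℕ := comap dyadicTime (𝓝[>] t)

instance (t : ℝ≥0) : (rightFilter t).IsCountablyGenerated :=
  inferInstanceAs (comap dyadicTime (𝓝[>] t)).IsCountablyGenerated

instance (t : ℝ≥0) : (rightFilter t).NeBot := by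
  refine comap_neBot fun U hU ↦ ?_
  obtain ⟨b, hb, hU⟩ := (mem_nhdsGT_iff_exists_Ioo_subset).1 hU
  obtain ⟨i, h1, h2⟩ := exists_dyadicTime_between hb
  exact ⟨i, hU ⟨h1, h2⟩⟩

lemma comap_dyadicTime_nhdsLT_neBot {t : ℝ≥0} (ht : 0 < t) :
    (comap dyadicTime (𝓝[<] t)).NeBot := by
  refine comap_neBot fun U hU ↦ ?_
  obtain ⟨b, hb, hU⟩ := (mem_nhdsLT_iff_exists_Ioo_subset' ht).1 hU
  obtain ⟨i, h1, h2⟩ := exists_dyadicTime_between hb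
  exact ⟨i, hU ⟨h1, h2⟩⟩

lemma eventually_rightFilter {s t : ℝ≥0} (h : s < t) :
    ∀ᶠ i in rightFilter s, s < dyadicTime i ∧ dyadicTime i < t :=
  ⟨Set.Ioo s t, Ioo_mem_nhdsGT h, fun _ hi ↦ hi⟩

/-- The values of a path at the dyadic times. -/
def dyadicValues (ω : PathSpace E x₀) (i : ℕ) : WithCemetery E := ω.toFun (dyadicTime i)

lemma tendsto_dyadicValues (ω : PathSpace E x₀) (t : ℝ≥0) :
    Tendsto (dyadicValues ω) (rightFilter t) (𝓝 (ω.toFun t)) :=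
  (tendsto_toFun_nhdsGT ω t).comp tendsto_comap

variable [MeasurableSpace E]

/-! ### Measurability on the path space -/

lemma measurable_pathSpace_iff {α : Type*} [MeasurableSpace α] {f : α → PathSpace E x₀} :
    Measurable f ↔ ∀ t, Measurable fun a ↦ (f a).toFun t := by
  rw [measurable_iff_comap_le, instMeasurableSpacePathSpace, MeasurableSpace.comap_iSup,
    iSup_le_iff]
  refine forall_congr' fun t ↦ ?_
  rw [MeasurableSpace.comap_comp, ← measurable_iff_comap_le]
  rfl

lemma measurable_toFun_naturalFiltration {s t : ℝ≥0} (h : s ≤ t) :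
    Measurable[naturalFiltration E x₀ t] fun ω : PathSpace E x₀ ↦ ω.toFun s :=
  Measurable.mono (comap_measurable (canonicalProcess s))
    (le_iSup₂_of_le (f := fun (s : ℝ≥0) (_ : s ≤ t) ↦
      MeasurableSpace.comap (canonicalProcess (E := E) (x₀ := x₀) s) inferInstance) s h le_rfl)
    le_rfl

lemma measurableSet_lt_lifetime (t : ℝ≥0) :
    MeasurableSet[naturalFiltration E x₀ t] {ω | (t : WithTop ℝ≥0) < lifetime ω} := by
  have : {ω : PathSpace E x₀ | (t : WithTop ℝ≥0) < lifetime ω} =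
      (fun ω ↦ ω.toFun t) ⁻¹' (Set.range Sum.inl) := by
    ext ω
    simp only [Set.mem_ofPred_eq, lt_lifetime_iff, Set.mem_preimage, Set.mem_range]
    rcases ω.toFun t with y | ⟨⟩ <;> simp [cemetery]
  rw [this]
  exact measurable_toFun_naturalFiltration le_rfl measurableSet_range_inl

/-- Events of `𝓕_t` depend only on the path up to time `t`. -/
lemma mem_iff_of_eqOn {t : ℝ≥0} {A : Set (PathSpace E x₀)}
    (hA : MeasurableSet[naturalFiltration E x₀ t] A) {ω ω' : PathSpace E x₀}
    (h : ∀ s ≤ t, ω.toFun s = ω'.toFun s) : ω ∈ A ↔ ω' ∈ A := by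
  let m : MeasurableSpace (PathSpace E x₀) :=
    { MeasurableSet' := fun A ↦ ω ∈ A ↔ ω' ∈ A
      measurableSet_empty := by simp
      measurableSet_compl := fun s hs ↦ not_congr hs
      measurableSet_iUnion := fun f hf ↦ by simp [hf] }
  have hle : naturalFiltration E x₀ t ≤ m := by
    refine iSup₂_le fun s hs ↦ ?_
    rintro _ ⟨B, -, rfl⟩
    change ω.toFun s ∈ B ↔ ω'.toFun s ∈ B
    rw [h s hs]
  exact hle A hA

lemma filtrationPlus_eq (t : ℝ≥0) :
    filtrationPlus E x₀ t = ⨅ s > t, naturalFiltration E x₀ s :=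
  Filtration.rightCont_eq _ t

lemma filtrationPlus_le {s t : ℝ≥0} (h : s < t) :
    filtrationPlus E x₀ s ≤ naturalFiltration E x₀ t :=
  (filtrationPlus_eq s).trans_le (iInf₂_le t h)

lemma naturalFiltration_le_filtrationPlus (t : ℝ≥0) :
    naturalFiltration E x₀ t ≤ filtrationPlus E x₀ t :=
  Filtration.le_rightCont _ t

end

/-! ### Oscillations along the dyadic times -/

/-- `OscillationChain x ε b N a`: in the time interval `(a, b]` there are `N` successive pairs of
dyadic times across each of which `x` moves by more than `ε`. -/
def OscillationChain {W : Type*} [PseudoMetricSpace W] (x : ℕ → W) (ε : ℝ) (b : ℝ≥0) :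
    ℕ → ℝ≥0 → Prop
  | 0, _ => True
  | N + 1, a => ∃ p q, a < dyadicTime p ∧ dyadicTime p ≤ dyadicTime q ∧ dyadicTime q ≤ b ∧
      ε < dist (x p) (x q) ∧ OscillationChain x ε b N (dyadicTime q)

/-- For each of countably many thresholds tending to `0`, the number of oscillations of `x` on
`(0, b]` above that threshold is bounded. -/
def FiniteOscillations {W : Type*} [PseudoMetricSpace W] (x : ℕ → W) (b : ℝ≥0) : Prop :=
  ∀ m : ℕ, ∃ N, ¬ OscillationChain x (1 / ((m : ℝ) + 1)) b N 0

section

variable {W : Type*} [MetricSpace W] {x : ℕ → W} {ε : ℝ} {b : ℝ≥0}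

lemma OscillationChain.anti {N : ℕ} {a a' : ℝ≥0} (h : a ≤ a')
    (hc : OscillationChain x ε b N a') : OscillationChain x ε b N a := by
  cases N with
  | zero => trivial
  | succ N =>
    obtain ⟨p, q, h1, h2⟩ := hc
    exact ⟨p, q, h.trans_lt h1, h2⟩

/-- Failure of the Cauchy criterion along the dyadic times. -/
lemma exists_dist_gt_of_not_tendsto [CompleteSpace W] {F : Filter ℝ≥0}
    (hF : (comap dyadicTime F).NeBot) (h : ¬ ∃ l, Tendsto x (comap dyadicTime F) (𝓝 l)) :
    ∃ m : ℕ, ∀ U ∈ F, ∃ p q, dyadicTime p ∈ U ∧ dyadicTime q ∈ U ∧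
      dyadicTime p ≤ dyadicTime q ∧ 1 / ((m : ℝ) + 1) < dist (x p) (x q) := by
  by_contra hcon
  push Not at hcon
  refine h (cauchy_map_iff_exists_tendsto.1 ?_)
  refine Metric.cauchy_iff.2 ⟨hF.map x, fun ε hε ↦ ?_⟩
  obtain ⟨m, hm⟩ := exists_nat_one_div_lt hε
  obtain ⟨U, hU, hosc⟩ := hcon m
  refine ⟨x '' (dyadicTime ⁻¹' U), image_mem_map (preimage_mem_comap hU), ?_⟩
  rintro _ ⟨p, hp, rfl⟩ _ ⟨q, hq, rfl⟩
  rcases le_total (dyadicTime p) (dyadicTime q) with hpq | hpq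
  · exact (hosc p q hp hq hpq).trans_lt hm
  · rw [dist_comm]
    exact (hosc q p hq hp hpq).trans_lt hm

lemma FiniteOscillations.exists_tendsto_rightFilter [CompleteSpace W]
    (hx : FiniteOscillations x b) {t : ℝ≥0} (ht : t < b) :
    ∃ l, Tendsto x (rightFilter t) (𝓝 l) := by
  by_contra h
  obtain ⟨m, hm⟩ := exists_dist_gt_of_not_tendsto (inferInstanceAs (rightFilter t).NeBot) h
  have key : ∀ N, ∃ a > t, OscillationChain x (1 / ((m : ℝ) + 1)) b N a := by
    intro N
    induction N with
    | zero => exact ⟨b, ht, trivial⟩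
    | succ N ih =>
      obtain ⟨a, ha, hN⟩ := ih
      obtain ⟨p, q, hp, hq, hpq, hd⟩ := hm _ (Ioo_mem_nhdsGT (lt_min ha ht))
      obtain ⟨a', h1, h2⟩ := exists_between hp.1
      exact ⟨a', h1, p, q, h2, hpq, hq.2.le.trans (min_le_right _ _), hd,
        hN.anti (hq.2.le.trans (min_le_left _ _))⟩
  obtain ⟨N, hN⟩ := hx m
  obtain ⟨a, -, ha⟩ := key N
  exact hN (ha.anti zero_le)

lemma FiniteOscillations.exists_tendsto_left [CompleteSpace W]
    (hx : FiniteOscillations x b) {t : ℝ≥0} (ht0 : 0 < t) (ht : t ≤ b) :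
    ∃ l, Tendsto x (comap dyadicTime (𝓝[<] t)) (𝓝 l) := by
  by_contra h
  obtain ⟨m, hm⟩ := exists_dist_gt_of_not_tendsto (comap_dyadicTime_nhdsLT_neBot ht0) h
  have key : ∀ N, ∀ a < t, OscillationChain x (1 / ((m : ℝ) + 1)) b N a := by
    intro N
    induction N with
    | zero => exact fun _ _ ↦ trivial
    | succ N ih =>
      intro a ha
      obtain ⟨p, q, hp, hq, hpq, hd⟩ := hm _ (Ioo_mem_nhdsLT ha)
      exact ⟨p, q, hp.1, hpq, hq.2.le.trans ht, hd, ih _ hq.2⟩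
  obtain ⟨N, hN⟩ := hx m
  exact hN (key N 0 ht0)

/-- A càdlàg function on `[0, b]` has finitely many oscillations of a given size. The infimum of
the times `a` for which there are finitely many oscillations after `a` is such a time by existence
of right limits, and it is `0` by existence of left limits. -/
lemma finiteOscillations_of_cadlag {g : ℝ≥0 → W}
    (hr : ∀ t < b, ContinuousWithinAt g (Set.Ici t) t)
    (hl : ∀ t ≤ b, ∃ l, Tendsto g (𝓝[<] t) (𝓝 l)) :
    FiniteOscillations (fun i ↦ g (dyadicTime i)) b := by
  intro m
  set ε : ℝ := 1 / ((m : ℝ) + 1)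
  have hε : 0 < ε := by positivity
  set G : Set ℝ≥0 := {a | a ≤ b ∧ ∃ N, ¬ OscillationChain (fun i ↦ g (dyadicTime i)) ε b N a}
  have hbG : b ∈ G := by
    refine ⟨le_rfl, 1, ?_⟩
    rintro ⟨p, q, h1, h2, h3, -⟩
    exact absurd (h1.trans_le (h2.trans h3)) (lt_irrefl _)
  -- one more pair has to be allowed for when `(a, a')` carries no oscillation
  have hext : ∀ a a', a' ∈ G → a ≤ a' →
      (∀ s ∈ Set.Ioo a a', ∀ u ∈ Set.Ioo a a', dist (g s) (g u) ≤ ε) → a ∈ G := by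
    rintro a a' ⟨ha'b, N, hN⟩ haa' hosc
    refine ⟨haa'.trans ha'b, N + 1, ?_⟩
    rintro ⟨p, q, h1, h2, h3, h4, h5⟩
    rcases lt_or_ge (dyadicTime q) a' with hq | hq
    · exact absurd (hosc _ ⟨h1, h2.trans_lt hq⟩ _ ⟨h1.trans_le h2, hq⟩) (not_le.2 h4)
    · exact hN (h5.anti hq)
  have hosc : ∀ (F : Filter ℝ≥0) (l : W), Tendsto g F (𝓝 l) →
      ∃ U ∈ F, ∀ s ∈ U, ∀ u ∈ U, dist (g s) (g u) ≤ ε := by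
    intro F l h
    refine ⟨g ⁻¹' Metric.ball l (ε / 2), h (Metric.ball_mem_nhds l (by positivity)), ?_⟩
    intro s hs u hu
    have h1 : dist (g s) l < ε / 2 := hs
    have h2 : dist (g u) l < ε / 2 := hu
    linarith [dist_triangle_right (g s) (g u) l]
  set c := sInf G
  have hcb : c ≤ b := csInf_le' hbG
  have hcG : c ∈ G := by
    rcases hcb.eq_or_lt with h | h
    · rwa [h]
    obtain ⟨U, hU, hosc⟩ := hosc _ _ (hr c h)
    obtain ⟨d, hd, hdU⟩ := (mem_nhdsGE_iff_exists_Ico_subset' h).1 hU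
    obtain ⟨a', ha', had⟩ := exists_lt_of_csInf_lt ⟨b, hbG⟩ (show sInf G < d from hd)
    refine hext c a' ha' (csInf_le' ha') fun s hs u hu ↦ hosc s ?_ u ?_
    · exact hdU ⟨hs.1.le, hs.2.trans had⟩
    · exact hdU ⟨hu.1.le, hu.2.trans had⟩
  rcases eq_or_ne c 0 with h0 | h0
  · exact h0 ▸ hcG.2
  · obtain ⟨l, hl⟩ := hl c hcb
    obtain ⟨U, hU, hosc⟩ := hosc _ _ hl
    obtain ⟨a, ha, haU⟩ := (mem_nhdsLT_iff_exists_Ioo_subset' (pos_of_ne_zero h0)).1 hU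
    exact absurd (csInf_le' (hext a c hcG (le_of_lt ha)
      fun s hs u hu ↦ hosc s (haU hs) u (haU hu))) (not_le.2 ha)

lemma measurableSet_oscillationChain [SecondCountableTopology W] [MeasurableSpace W]
    [BorelSpace W] (ε : ℝ) (b : ℝ≥0) (N : ℕ) (a : ℝ≥0) :
    MeasurableSet {x : ℕ → W | OscillationChain x ε b N a} := by
  induction N generalizing a with
  | zero => exact MeasurableSet.univ
  | succ N ih =>
    simp only [OscillationChain]
    simp only [Set.ofPred_exists]
    refine MeasurableSet.iUnion fun p ↦ MeasurableSet.iUnion fun q ↦ ?_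
    refine (MeasurableSet.const _).inter ((MeasurableSet.const _).inter
      ((MeasurableSet.const _).inter (MeasurableSet.inter ?_ (ih _))))
    exact measurableSet_lt measurable_const
      ((measurable_pi_apply p).dist (measurable_pi_apply q))

lemma measurableSet_finiteOscillations [SecondCountableTopology W] [MeasurableSpace W]
    [BorelSpace W] (b : ℝ≥0) : MeasurableSet {x : ℕ → W | FiniteOscillations x b} := by
  simp only [FiniteOscillations, Set.ofPred_forall, Set.ofPred_exists]
  exact MeasurableSet.iInter fun m ↦ MeasurableSet.iUnion fun N ↦
    (measurableSet_oscillationChain (1 / ((m : ℝ) + 1)) b N 0).compl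

end

/-- If `w` consists of the right limits of `x`, then one-sided limits of `x` along the dyadic times
are limits of `w` along all times. -/
lemma tendsto_of_tendsto_comap_dyadicTime {W : Type*} [TopologicalSpace W] [RegularSpace W]
    {x : ℕ → W} {w : ℝ≥0 → W} (hw : ∀ s, Tendsto x (rightFilter s) (𝓝 (w s))) {I : Set ℝ≥0}
    (hI : IsOpen I) {t : ℝ≥0} {l : W} (h : Tendsto x (comap dyadicTime (𝓝[I] t)) (𝓝 l)) :
    Tendsto w (𝓝[I] t) (𝓝 l) := by
  refine (closed_nhds_basis l).tendsto_right_iff.2 fun V ⟨hV, hVc⟩ ↦ ?_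
  obtain ⟨U, hU, hUV⟩ := h hV
  filter_upwards [eventually_eventually_nhdsWithin.2 (eventually_mem_set.2 hU),
    self_mem_nhdsWithin] with s hs hsI
  rw [hI.nhdsWithin_eq hsI] at hs
  refine hVc.mem_of_tendsto (hw s) ?_
  filter_upwards [preimage_mem_comap (nhdsWithin_le_nhds (s := Set.Ioi s) hs)] with i hi
  exact hUV hi

/-! ### Reconstruction of a path from its values at dyadic times -/

/-- A family of values at the dyadic times, frozen after the `j`-th dyadic time. -/
def stopAt {W : Type*} (j : ℕ) (x : ℕ → W) (i : ℕ) : W :=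
  if dyadicTime i ≤ dyadicTime j then x i else x j

lemma measurable_stopAt {W : Type*} [MeasurableSpace W] (j : ℕ) :
    Measurable (stopAt j : (ℕ → W) → ℕ → W) := by
  refine measurable_pi_iff.2 fun i ↦ ?_
  unfold stopAt
  split_ifs <;> exact measurable_pi_apply _

/-- A family of values at the dyadic times, sent to the cemetery after time `s`. -/
def killAfter {E : Type*} (s : ℝ≥0) (x : ℕ → WithCemetery E) (i : ℕ) : WithCemetery E :=
  if dyadicTime i ≤ s then x i else cemetery

lemma measurable_killAfter {E : Type*} [MeasurableSpace E] (s : ℝ≥0) :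
    Measurable (killAfter s : (ℕ → WithCemetery E) → ℕ → WithCemetery E) := by
  refine measurable_pi_iff.2 fun i ↦ ?_
  unfold killAfter
  split_ifs
  · exact measurable_pi_apply _
  · exact measurable_const

lemma measurableSet_ne_cemetery {E : Type*} [MeasurableSpace E] (i : ℕ) :
    MeasurableSet {x : ℕ → WithCemetery E | x i ≠ cemetery} := by
  have h : MeasurableSet ({cemetery}ᶜ : Set (WithCemetery E)) := by
    have : ({cemetery}ᶜ : Set (WithCemetery E)) = Set.range Sum.inl := by
      ext (y | ⟨⟩) <;> simp [cemetery]
    exact this ▸ measurableSet_range_inl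
  exact (measurable_pi_apply i : Measurable fun x : ℕ → WithCemetery E ↦ x i) h

lemma stopAt_killAfter {E : Type*} {i : ℕ} {s : ℝ≥0} (h : dyadicTime i ≤ s)
    (x : ℕ → WithCemetery E) : stopAt i (killAfter s x) = stopAt i x := by
  funext k
  unfold stopAt killAfter
  by_cases hk : dyadicTime k ≤ dyadicTime i
  · simp [hk, hk.trans h]
  · simp [hk, h]

lemma stopAt_eventuallyEq {W : Type*} (j : ℕ) (x : ℕ → W) {F : Filter ℝ≥0}
    (hF : Set.Iio (dyadicTime j) ∈ F) : stopAt j x =ᶠ[comap dyadicTime F] x :=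
  ⟨_, hF, fun _ hi ↦ if_pos (le_of_lt hi)⟩

lemma tendsto_cemetery_of_forall {E : Type*} [TopologicalSpace E] {x : ℕ → WithCemetery E}
    {t : ℝ≥0} (h : ∀ j, t < dyadicTime j → x j = cemetery) :
    Tendsto x (rightFilter t) (𝓝 cemetery) := by
  refine tendsto_const_nhds.congr' ?_
  filter_upwards [eventually_rightFilter (lt_add_one t)] with i hi
  exact (h i hi.1).symm

section

variable {E : Type*} [TopologicalSpace E] [PolishSpace E]

/-- The values at dyadic times come from a path in `E`, càdlàg on `[0, b]` and started at `x₀`. -/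
def RegularUpTo (x₀ : E) (b : ℝ≥0) (y : ℕ → WithCemetery E) : Prop :=
  letI := TopologicalSpace.upgradeIsCompletelyMetrizable (WithCemetery E)
  (∀ i, y i ≠ cemetery) ∧ FiniteOscillations y b ∧
    (0 < b → Tendsto y (rightFilter 0) (𝓝 (Sum.inl x₀)))

/-- The values at dyadic times which are not killed at once, and which are regular up to each
time at which they are alive. -/
def RegularValues (x₀ : E) (x : ℕ → WithCemetery E) : Prop :=
  (∃ j, 0 < dyadicTime j ∧ x j ≠ cemetery) ∧
    ∀ j, x j ≠ cemetery → RegularUpTo x₀ (dyadicTime j) (stopAt j x)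

variable {x₀ : E} {x : ℕ → WithCemetery E}

lemma RegularValues.ne_cemetery_of_le (hx : RegularValues x₀ x) {i j : ℕ}
    (hij : dyadicTime i ≤ dyadicTime j) (hj : x j ≠ cemetery) : x i ≠ cemetery := by
  have := (hx.2 j hj).1 i
  rwa [stopAt, if_pos hij] at this

lemma RegularValues.exists_tendsto_of_alive (hx : RegularValues x₀ x) {j : ℕ}
    (hj : x j ≠ cemetery) {t : ℝ≥0} (ht : t < dyadicTime j) :
    ∃ l, l ≠ cemetery ∧ Tendsto x (rightFilter t) (𝓝 l) := by
  let := TopologicalSpace.upgradeIsCompletelyMetrizable (WithCemetery E)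
  obtain ⟨h1, h2, -⟩ := hx.2 j hj
  obtain ⟨l, hl⟩ := FiniteOscillations.exists_tendsto_rightFilter h2 ht
  refine ⟨l, isOpen_cemetery.isClosed_compl.mem_of_tendsto hl (Eventually.of_forall h1), ?_⟩
  exact hl.congr' (stopAt_eventuallyEq j x (mem_nhdsWithin_of_mem_nhds (Iio_mem_nhds ht)))

lemma RegularValues.exists_tendsto (hx : RegularValues x₀ x) (t : ℝ≥0) :
    ∃ l, Tendsto x (rightFilter t) (𝓝 l) := by
  by_cases h : ∀ j, t < dyadicTime j → x j = cemetery
  · exact ⟨_, tendsto_cemetery_of_forall h⟩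
  · push Not at h
    obtain ⟨j, hj, hj'⟩ := h
    obtain ⟨l, -, hl⟩ := hx.exists_tendsto_of_alive hj' hj
    exact ⟨l, hl⟩

/-- The right limits of regular values at dyadic times. -/
def rightLimit (hx : RegularValues x₀ x) (t : ℝ≥0) : WithCemetery E :=
  (hx.exists_tendsto t).choose

lemma tendsto_rightLimit (hx : RegularValues x₀ x) (t : ℝ≥0) :
    Tendsto x (rightFilter t) (𝓝 (rightLimit hx t)) :=
  (hx.exists_tendsto t).choose_spec

lemma rightLimit_ne_cemetery_iff (hx : RegularValues x₀ x) (t : ℝ≥0) :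
    rightLimit hx t ≠ cemetery ↔ ∃ j, t < dyadicTime j ∧ x j ≠ cemetery := by
  constructor
  · intro h
    by_contra hcon
    push Not at hcon
    exact h (tendsto_nhds_unique (tendsto_rightLimit hx t) (tendsto_cemetery_of_forall hcon))
  · rintro ⟨j, hj, hj'⟩
    obtain ⟨l, hl, hl'⟩ := hx.exists_tendsto_of_alive hj' hj
    rwa [tendsto_nhds_unique (tendsto_rightLimit hx t) hl']

lemma exists_alive_of_lt_pathLifetime (hx : RegularValues x₀ x) {t : ℝ≥0}
    (ht : (t : WithTop ℝ≥0) < pathLifetime (rightLimit hx)) :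
    ∃ j, t < dyadicTime j ∧ x j ≠ cemetery := by
  rw [← rightLimit_ne_cemetery_iff hx]
  exact fun h ↦ absurd ht (not_lt.2 (iInf₂_le t h))

lemma rightLimit_eq_cemetery (hx : RegularValues x₀ x) {t : ℝ≥0}
    (ht : pathLifetime (rightLimit hx) ≤ (t : WithTop ℝ≥0)) : rightLimit hx t = cemetery := by
  by_contra h
  obtain ⟨j, hj, hj'⟩ := (rightLimit_ne_cemetery_iff hx t).1 h
  refine absurd ht (not_le.2 ((WithTop.coe_lt_coe.2 hj).trans_le (le_iInf₂ fun s hs ↦ ?_)))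
  by_contra hsj
  exact (rightLimit_ne_cemetery_iff hx s).2 ⟨j, WithTop.coe_lt_coe.1 (not_le.1 hsj), hj'⟩ hs

/-- The path of the right limits of regular values at dyadic times. -/
def regularPath (hx : RegularValues x₀ x) : PathSpace E x₀ where
  toFun := rightLimit hx
  start := by
    obtain ⟨j, hj, hj'⟩ := hx.1
    refine tendsto_nhds_unique (tendsto_rightLimit hx 0) (((hx.2 j hj').2.2 hj).congr' ?_)
    exact stopAt_eventuallyEq j x (mem_nhdsWithin_of_mem_nhds (Iio_mem_nhds hj))
  right_continuous t _ := by
    rw [← continuousWithinAt_Ioi_iff_Ici]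
    exact tendsto_of_tendsto_comap_dyadicTime (tendsto_rightLimit hx) isOpen_Ioi
      (tendsto_rightLimit hx t)
  left_limit t ht := by
    let := TopologicalSpace.upgradeIsCompletelyMetrizable (WithCemetery E)
    obtain ⟨j, hj, hj'⟩ := exists_alive_of_lt_pathLifetime hx ht
    rcases eq_or_ne t 0 with rfl | h0
    · exact ⟨cemetery, by simp⟩
    · obtain ⟨l, hl⟩ := FiniteOscillations.exists_tendsto_left (hx.2 j hj').2.1
        (pos_of_ne_zero h0) hj.le
      refine ⟨l, tendsto_of_tendsto_comap_dyadicTime (tendsto_rightLimit hx) isOpen_Iio ?_⟩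
      exact hl.congr' (stopAt_eventuallyEq j x (mem_nhdsWithin_of_mem_nhds (Iio_mem_nhds hj)))
  constant s t hs ht := by rw [rightLimit_eq_cemetery hx hs, rightLimit_eq_cemetery hx ht]

open scoped Classical in
/-- The path with given values at dyadic times; the constant path at irregular values. -/
def toPath (x₀ : E) (x : ℕ → WithCemetery E) : PathSpace E x₀ :=
  if hx : RegularValues x₀ x then regularPath hx else constPath E x₀

lemma tendsto_toPath (hx : RegularValues x₀ x) (t : ℝ≥0) :
    Tendsto x (rightFilter t) (𝓝 ((toPath x₀ x).toFun t)) := by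
  rw [toPath, dif_pos hx]
  exact tendsto_rightLimit hx t

lemma lt_lifetime_toPath_iff (hx : RegularValues x₀ x) (t : ℝ≥0) :
    (t : WithTop ℝ≥0) < lifetime (toPath x₀ x) ↔ ∃ j, t < dyadicTime j ∧ x j ≠ cemetery := by
  rw [lt_lifetime_iff, toPath, dif_pos hx]
  exact rightLimit_ne_cemetery_iff hx t

lemma regularUpTo_stopAt_dyadicValues (ω : PathSpace E x₀) {j : ℕ}
    (hj : dyadicValues ω j ≠ cemetery) :
    RegularUpTo x₀ (dyadicTime j) (stopAt j (dyadicValues ω)) := by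
  let := TopologicalSpace.upgradeIsCompletelyMetrizable (WithCemetery E)
  have hlt {t : ℝ≥0} (ht : t ≤ dyadicTime j) : (t : WithTop ℝ≥0) < lifetime ω :=
    (WithTop.coe_le_coe.2 ht).trans_lt ((lt_lifetime_iff ω _).2 hj)
  refine ⟨fun i ↦ ?_, ?_, fun h ↦ ?_⟩
  · unfold stopAt
    split_ifs with h
    · exact fun hi ↦ hj (toFun_eq_cemetery_of_le h hi)
    · exact hj
  · -- the stopped values are the dyadic values of the stopped path
    have hg : stopAt j (dyadicValues ω) =
        fun i ↦ ω.toFun (min (dyadicTime i) (dyadicTime j)) := by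
      funext i
      unfold stopAt dyadicValues
      split_ifs with h
      · rw [min_eq_left h]
      · rw [min_eq_right (le_of_not_ge h)]
    rw [hg]
    refine finiteOscillations_of_cadlag (g := fun t ↦ ω.toFun (min t (dyadicTime j)))
      (fun t ht ↦ ?_) (fun t ht ↦ ?_)
    · refine (ω.right_continuous t (hlt ht.le)).congr_of_eventuallyEq ?_ (by rw [min_eq_left ht.le])
      filter_upwards [mem_nhdsWithin_of_mem_nhds (Iio_mem_nhds ht)] with s hs
      rw [min_eq_left (le_of_lt hs)]
    · obtain ⟨l, hl⟩ := ω.left_limit t (hlt ht)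
      refine ⟨l, hl.congr' ?_⟩
      filter_upwards [self_mem_nhdsWithin] with s hs
      rw [min_eq_left ((le_of_lt hs).trans ht)]
  · rw [← ω.start]
    refine (tendsto_dyadicValues ω 0).congr' (EventuallyEq.symm ?_)
    exact stopAt_eventuallyEq j _ (mem_nhdsWithin_of_mem_nhds (Iio_mem_nhds h))

lemma regularValues_dyadicValues (ω : PathSpace E x₀) :
    RegularValues x₀ (dyadicValues ω) := by
  refine ⟨?_, fun j hj ↦ regularUpTo_stopAt_dyadicValues ω hj⟩
  have h1 : ∀ᶠ i in rightFilter 0, dyadicValues ω i ≠ cemetery := by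
    refine (tendsto_dyadicValues ω 0).eventually
      ((isClosed_singleton (x := (cemetery : WithCemetery E))).isOpen_compl.mem_nhds ?_)
    rw [ω.start]
    exact inl_ne_cemetery x₀
  obtain ⟨i, h, h'⟩ := (h1.and (eventually_rightFilter zero_lt_one)).exists
  exact ⟨i, h'.1, h⟩

lemma toPath_dyadicValues (ω : PathSpace E x₀) : toPath x₀ (dyadicValues ω) = ω :=
  PathSpace.ext' (funext fun t ↦ tendsto_nhds_unique
    (tendsto_toPath (regularValues_dyadicValues ω) t) (tendsto_dyadicValues ω t))

lemma RegularValues.killAfter (hx : RegularValues x₀ x) {j : ℕ} (hj : x j ≠ cemetery)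
    (hj0 : 0 < dyadicTime j) : RegularValues x₀ (killAfter (dyadicTime j) x) := by
  refine ⟨⟨j, hj0, by simpa [ExitMeasure.killAfter] using hj⟩, fun i hi ↦ ?_⟩
  have hij : dyadicTime i ≤ dyadicTime j := by
    by_contra h
    exact hi (if_neg h)
  rw [stopAt_killAfter hij]
  exact hx.2 i (hx.ne_cemetery_of_le hij hj)

/-- Killing after a time at which the path is alive does not change the path before that time. -/
lemma toPath_killAfter (hx : RegularValues x₀ x) {j : ℕ} (hj : x j ≠ cemetery) {t : ℝ≥0}
    (ht : t < dyadicTime j) :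
    (toPath x₀ (killAfter (dyadicTime j) x)).toFun t = (toPath x₀ x).toFun t := by
  have h := tendsto_toPath (hx.killAfter hj (zero_le.trans_lt ht)) t
  refine tendsto_nhds_unique h ((tendsto_toPath hx t).congr' ?_)
  filter_upwards [eventually_rightFilter ht] with i hi
  exact (if_pos hi.2.le).symm

variable [MeasurableSpace E] [BorelSpace E]

lemma measurableSet_regularUpTo (x₀ : E) (b : ℝ≥0) :
    MeasurableSet {y | RegularUpTo x₀ b y} := by
  let := TopologicalSpace.upgradeIsCompletelyMetrizable (WithCemetery E)
  refine MeasurableSet.inter ?_ ((measurableSet_finiteOscillations b).inter ?_)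
  · change MeasurableSet {y : ℕ → WithCemetery E | ∀ i, y i ≠ cemetery}
    rw [Set.ofPred_forall]
    exact MeasurableSet.iInter measurableSet_ne_cemetery
  by_cases hb : 0 < b
  · simp only [hb, forall_const]
    exact measurableSet_tendsto _ fun i ↦ measurable_pi_apply i
  · simp only [hb, false_imp_iff]
    exact MeasurableSet.univ

lemma measurableSet_regularValues (x₀ : E) : MeasurableSet {x | RegularValues x₀ x} := by
  refine MeasurableSet.inter ?_ ?_
  · change MeasurableSet {x : ℕ → WithCemetery E | ∃ j, 0 < dyadicTime j ∧ x j ≠ cemetery}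
    rw [Set.ofPred_exists]
    exact MeasurableSet.iUnion fun j ↦ (MeasurableSet.const _).inter (measurableSet_ne_cemetery j)
  · change MeasurableSet {x : ℕ → WithCemetery E |
      ∀ j, x j ≠ cemetery → RegularUpTo x₀ (dyadicTime j) (stopAt j x)}
    rw [Set.ofPred_forall]
    refine MeasurableSet.iInter fun j ↦ MeasurableSet.imp (measurableSet_ne_cemetery j) ?_
    exact measurable_stopAt j (measurableSet_regularUpTo x₀ (dyadicTime j))

lemma measurable_toPath (x₀ : E) : Measurable (toPath x₀ : (ℕ → WithCemetery E) → _) := by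
  classical
  refine measurable_pathSpace_iff.2 fun t ↦ ?_
  obtain ⟨u, hu⟩ := (rightFilter t).exists_seq_tendsto
  refine measurable_of_tendsto_metrizable
    (f := fun k (x : ℕ → WithCemetery E) ↦
      if x ∈ {x | RegularValues x₀ x} then x (u k) else Sum.inl x₀)
    (fun k ↦ Measurable.ite (measurableSet_regularValues x₀) (measurable_pi_apply _)
      measurable_const) (tendsto_pi_nhds.2 fun x ↦ ?_)
  by_cases hx : RegularValues x₀ x
  · simp only [Set.mem_ofPred_eq, hx, if_true]
    exact (tendsto_toPath hx t).comp hu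
  · simp only [Set.mem_ofPred_eq, hx, if_false, toPath, dif_neg, not_false_eq_true]
    exact tendsto_const_nhds

end

/-! ### Laws of paths killed on a dyadic grid -/

/-- The first `n + 1` dyadic times are grid points of mesh `2⁻ⁿ` in `[0, 2ⁿ]`, by the bounds for the
pairing function in `dyadicTime`. -/
lemma exists_dyadicTime_eq_grid {i n : ℕ} (h : i ≤ n) :
    ∃ c : ℕ, c ≤ 4 ^ n ∧ dyadicTime i = c / 2 ^ n := by
  have h1 := Nat.unpair_left_le i
  have h2 := Nat.unpair_right_le i
  refine ⟨(Nat.unpair i).1 * 2 ^ (n - (Nat.unpair i).2), ?_, ?_⟩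
  · calc (Nat.unpair i).1 * 2 ^ (n - (Nat.unpair i).2) ≤ 2 ^ n * 2 ^ n := by
          refine Nat.mul_le_mul ((h1.trans h).trans Nat.lt_two_pow_self.le) ?_
          exact Nat.pow_le_pow_right (by norm_num) (Nat.sub_le _ _)
      _ = 4 ^ n := by rw [← mul_pow]; norm_num
  · have h3 : (2 : ℝ≥0) ^ n = 2 ^ (n - (Nat.unpair i).2) * 2 ^ (Nat.unpair i).2 := by
      rw [← pow_add, Nat.sub_add_cancel (h2.trans h)]
    rw [dyadicTime, h3]
    push_cast
    field_simp

lemma grid_le_grid_iff {n c k : ℕ} :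
    (c : ℝ≥0) / 2 ^ n ≤ (k : ℝ≥0) / 2 ^ n ↔ c ≤ k := by
  rw [div_le_div_iff_of_pos_right (by positivity), Nat.cast_le]

lemma grid_succ (n c : ℕ) : (c : ℝ≥0) / 2 ^ n = ((2 * c : ℕ) : ℝ≥0) / 2 ^ (n + 1) := by
  rw [pow_succ]
  push_cast
  field_simp

lemma sum_range_two_mul_eq (M : ℕ) (f : ℕ → ℝ) :
    ∑ k ∈ Finset.range (2 * M), f k = ∑ k ∈ Finset.range M, (f (2 * k) + f (2 * k + 1)) := by
  induction M with
  | zero => simp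
  | succ M ih => rw [mul_add, mul_one, Finset.sum_range_succ, Finset.sum_range_succ, ih,
      Finset.sum_range_succ]; ring

section

variable {E : Type*} [TopologicalSpace E] {x₀ : E}

/-- The dyadic values of a path killed after time `s`. -/
def killedValues (s : ℝ≥0) (ω : PathSpace E x₀) : ℕ → WithCemetery E :=
  killAfter s (dyadicValues ω)

lemma killAfter_killedValues {s t : ℝ≥0} (h : t ≤ s) (ω : PathSpace E x₀) :
    killAfter t (killedValues s ω) = killedValues t ω := by
  funext i
  unfold killedValues killAfter
  by_cases hi : dyadicTime i ≤ t
  · simp [hi, hi.trans h]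
  · simp [hi]

/-- Killing times which are not separated by the first `n + 1` dyadic times are not distinguished
by events of the first `n + 1` coordinates. -/
lemma preimage_killedValues_congr {n : ℕ} {s t : ℝ≥0}
    (h : ∀ i ≤ n, (dyadicTime i ≤ s ↔ dyadicTime i ≤ t))
    (B : Set (∀ _ : Finset.Iic n, WithCemetery E)) :
    (killedValues s : PathSpace E x₀ → _) ⁻¹' (Preorder.frestrictLe n ⁻¹' B) =
      killedValues t ⁻¹' (Preorder.frestrictLe n ⁻¹' B) := by
  have (ω : PathSpace E x₀) : Preorder.frestrictLe (π := fun _ ↦ WithCemetery E) n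
      (killedValues s ω) = Preorder.frestrictLe n (killedValues t ω) := by
    funext i
    simp only [Preorder.frestrictLe_apply, killedValues, killAfter, h i (Finset.mem_Iic.1 i.2)]
  ext ω
  simp only [Set.mem_preimage, this]

variable [MeasurableSpace E]

lemma measurable_killedValues_naturalFiltration (s : ℝ≥0) :
    Measurable[naturalFiltration E x₀ s] (killedValues s : PathSpace E x₀ → _) := by
  refine @measurable_pi_iff _ _ _ (naturalFiltration E x₀ s) _ _ |>.2 fun i ↦ ?_
  unfold killedValues killAfter dyadicValues
  split_ifs with h
  · exact measurable_toFun_naturalFiltration h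
  · exact measurable_const

lemma measurable_killedValues (s : ℝ≥0) :
    Measurable (killedValues s : PathSpace E x₀ → _) :=
  (measurable_killedValues_naturalFiltration s).mono ((naturalFiltration E x₀).le s) le_rfl

/-- A family `m` of measures on the path space which is a candidate for
`m t A = Q (A ∩ {t < ζ})`, `A ∈ 𝓕_t`, with `Q` a probability. -/
structure IsSurvivalFamily (m : ℝ≥0 → Measure (PathSpace E x₀)) : Prop where
  isFinite : ∀ t, IsFiniteMeasure (m t)
  zero : m 0 Set.univ = 1
  anti : ∀ s t, s ≤ t → ∀ A, MeasurableSet[naturalFiltration E x₀ s] A → m t A ≤ m s A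
  alive : ∀ t, m t {ω | ω.toFun t = cemetery} = 0

/-- The law of a path which, if it is not alive at the grid point `(k + 1) / 2 ^ n`, is killed right
after the last grid point at which it is alive; here `m t` governs survival up to time `t`. -/
def gridLaw (m : ℝ≥0 → Measure (PathSpace E x₀)) (n : ℕ) : Measure (ℕ → WithCemetery E) :=
  (m ((4 ^ n : ℕ) / 2 ^ n)).map (killedValues ((4 ^ n : ℕ) / 2 ^ n)) +
    ∑ k ∈ Finset.range (4 ^ n), ((m (k / 2 ^ n)).map (killedValues (k / 2 ^ n)) -
      (m ((k + 1 : ℕ) / 2 ^ n)).map (killedValues (k / 2 ^ n)))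

variable {m : ℝ≥0 → Measure (PathSpace E x₀)}

lemma IsSurvivalFamily.map_killedValues_le (hm : IsSurvivalFamily m) {s t : ℝ≥0} (h : s ≤ t) :
    (m t).map (killedValues s) ≤ (m s).map (killedValues s) := by
  refine Measure.le_iff.2 fun A hA ↦ ?_
  rw [Measure.map_apply (measurable_killedValues s) hA,
    Measure.map_apply (measurable_killedValues s) hA]
  exact hm.anti s t h _ (measurable_killedValues_naturalFiltration s hA)

lemma IsSurvivalFamily.isFiniteMeasure_gridLaw (hm : IsSurvivalFamily m) (n : ℕ) :
    IsFiniteMeasure (gridLaw m n) := by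
  have := hm.isFinite
  unfold gridLaw
  infer_instance

/-- The increment of `gridLaw` caused by one more grid point. -/
def gridIncrement (m : ℝ≥0 → Measure (PathSpace E x₀)) (n : ℕ) (A : Set (ℕ → WithCemetery E))
    (k : ℕ) : ℝ :=
  (m ((k + 1 : ℕ) / 2 ^ n)).real (killedValues ((k + 1 : ℕ) / 2 ^ n) ⁻¹' A) -
    (m ((k + 1 : ℕ) / 2 ^ n)).real (killedValues (k / 2 ^ n) ⁻¹' A)

lemma IsSurvivalFamily.gridLaw_real (hm : IsSurvivalFamily m) (n : ℕ)
    {A : Set (ℕ → WithCemetery E)} (hA : MeasurableSet A) :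
    (gridLaw m n).real A = (m 0).real (killedValues 0 ⁻¹' A) +
      ∑ k ∈ Finset.range (4 ^ n), gridIncrement m n A k := by
  have := hm.isFinite
  have hmap (s t : ℝ≥0) : ((m t).map (killedValues s)).real A =
      (m t).real (killedValues s ⁻¹' A) := map_measureReal_apply (measurable_killedValues s) hA
  have hsub (k : ℕ) : ((m (k / 2 ^ n)).map (killedValues (k / 2 ^ n)) -
      (m ((k + 1 : ℕ) / 2 ^ n)).map (killedValues (k / 2 ^ n))).real A =
      (m (k / 2 ^ n)).real (killedValues (k / 2 ^ n) ⁻¹' A) -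
        (m ((k + 1 : ℕ) / 2 ^ n)).real (killedValues (k / 2 ^ n) ⁻¹' A) := by
    have hle := hm.map_killedValues_le (grid_le_grid_iff (n := n).2 k.le_succ)
    rw [← hmap, ← hmap, Measure.real, Measure.sub_apply hA hle,
      ENNReal.toReal_sub_of_le (hle A) (measure_ne_top _ _)]
    rfl
  have hsum : ∀ s : Finset ℕ, (∑ k ∈ s, ((m (k / 2 ^ n)).map (killedValues (k / 2 ^ n)) -
      (m ((k + 1 : ℕ) / 2 ^ n)).map (killedValues (k / 2 ^ n)))).real A =
      ∑ k ∈ s, ((m (k / 2 ^ n)).real (killedValues (k / 2 ^ n) ⁻¹' A) -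
        (m ((k + 1 : ℕ) / 2 ^ n)).real (killedValues (k / 2 ^ n) ⁻¹' A)) := by
    intro s
    rw [Measure.real, Measure.finsetSum_apply, ENNReal.toReal_sum fun _ _ ↦ measure_ne_top _ _]
    exact Finset.sum_congr rfl fun k _ ↦ hsub k
  rw [gridLaw, measureReal_add_apply, hmap, hsum, Finset.sum_sub_distrib]
  have h1 := Finset.sum_range_succ
    (fun k : ℕ ↦ (m (k / 2 ^ n)).real (killedValues (k / 2 ^ n) ⁻¹' A)) (4 ^ n)
  have h2 := Finset.sum_range_succ'
    (fun k : ℕ ↦ (m (k / 2 ^ n)).real (killedValues (k / 2 ^ n) ⁻¹' A)) (4 ^ n)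
  simp only [Nat.cast_zero, zero_div] at h2
  simp only [gridIncrement, Finset.sum_sub_distrib]
  linarith

lemma IsSurvivalFamily.isProbabilityMeasure_gridLaw (hm : IsSurvivalFamily m) (n : ℕ) :
    IsProbabilityMeasure (gridLaw m n) := by
  have h := hm.gridLaw_real n MeasurableSet.univ
  have := hm.isFiniteMeasure_gridLaw n
  simp only [gridIncrement, Set.preimage_univ, sub_self, Finset.sum_const_zero, add_zero] at h
  refine ⟨?_⟩
  rw [measureReal_def, measureReal_def, hm.zero] at h
  simpa using (ENNReal.toReal_eq_one_iff _).1 (h.trans ENNReal.toReal_one)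

/-- The grid laws are consistent: a grid point between (or beyond) those seen by the coordinates
does not contribute, and the remaining increments agree. -/
lemma IsSurvivalFamily.gridLaw_succ (hm : IsSurvivalFamily m) (n : ℕ) :
    (gridLaw m (n + 1)).map (Preorder.frestrictLe n) =
      (gridLaw m n).map (Preorder.frestrictLe n) := by
  have := hm.isFiniteMeasure_gridLaw n
  have := hm.isFiniteMeasure_gridLaw (n + 1)
  ext B hB
  have hA := Preorder.measurable_frestrictLe (X := fun _ ↦ WithCemetery E) n hB
  rw [Measure.map_apply (by fun_prop) hB, Measure.map_apply (by fun_prop) hB,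
    ← ENNReal.toReal_eq_toReal_iff' (measure_ne_top _ _) (measure_ne_top _ _)]
  change (gridLaw m (n + 1)).real _ = (gridLaw m n).real _
  rw [hm.gridLaw_real _ hA, hm.gridLaw_real _ hA]
  congr 1
  have hstep (k : ℕ) (h : ∀ c ≤ 4 ^ n, 2 * c ≤ k + 1 ↔ 2 * c ≤ k) :
      (killedValues (((k + 1 : ℕ) : ℝ≥0) / 2 ^ (n + 1)) : PathSpace E x₀ → _) ⁻¹'
        (Preorder.frestrictLe n ⁻¹' B) =
      killedValues ((k : ℝ≥0) / 2 ^ (n + 1)) ⁻¹' (Preorder.frestrictLe n ⁻¹' B) := by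
    refine preimage_killedValues_congr (fun i hi ↦ ?_) B
    obtain ⟨c, hc, h'⟩ := exists_dyadicTime_eq_grid hi
    rw [h', grid_succ n c, grid_le_grid_iff, grid_le_grid_iff, h c hc]
  have htail : ∀ k ∈ Finset.range (4 ^ (n + 1)), k ∉ Finset.range (2 * 4 ^ n) →
      gridIncrement m (n + 1) (Preorder.frestrictLe n ⁻¹' B) k = 0 := by
    intro k _ hk
    rw [Finset.mem_range, not_lt] at hk
    rw [gridIncrement, hstep k fun c hc ↦ by omega, sub_self]
  rw [← Finset.sum_subset (Finset.range_subset_range.2 (by rw [pow_succ]; omega)) htail,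
    sum_range_two_mul_eq]
  refine Finset.sum_congr rfl fun k _ ↦ ?_
  have h1 : gridIncrement m (n + 1) (Preorder.frestrictLe n ⁻¹' B) (2 * k) = 0 := by
    rw [gridIncrement, hstep (2 * k) fun c hc ↦ by omega, sub_self]
  rw [h1, zero_add, gridIncrement, gridIncrement, hstep (2 * k) fun c hc ↦ by omega,
    grid_succ n (k + 1), grid_succ n k]
  rfl

/-- Before the death of the path, the grid laws are governed by `m`. -/
lemma IsSurvivalFamily.gridLaw_alive (hm : IsSurvivalFamily m) {j n : ℕ} (hj : j ≤ n)
    {B : Set (ℕ → WithCemetery E)} (hB : MeasurableSet B) :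
    (gridLaw m n) {x | x j ≠ cemetery ∧ killAfter (dyadicTime j) x ∈ B} =
      m (dyadicTime j) (killedValues (dyadicTime j) ⁻¹' B) := by
  have := hm.isFinite
  have := hm.isFiniteMeasure_gridLaw n
  set t := dyadicTime j
  set A : Set (ℕ → WithCemetery E) := {x | x j ≠ cemetery ∧ killAfter t x ∈ B}
  have hA : MeasurableSet A := (measurableSet_ne_cemetery j).inter (measurable_killAfter t hB)
  set D : Set (PathSpace E x₀) := {ω | ω.toFun t ≠ cemetery} ∩ killedValues t ⁻¹' B
  have hD : m t D = m t (killedValues t ⁻¹' B) := by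
    refine Measure.measure_inter_eq_of_ae ?_
    exact measure_mono_null (fun ω h ↦ not_not.1 h) (hm.alive t)
  have hge (s : ℝ≥0) (hs : t ≤ s) : (killedValues s : PathSpace E x₀ → _) ⁻¹' A = D := by
    ext ω
    change killedValues s ω j ≠ cemetery ∧ killAfter t (killedValues s ω) ∈ B ↔ _
    rw [killAfter_killedValues hs]
    simp only [killedValues, killAfter, show dyadicTime j ≤ s from hs, if_true]
    rfl
  have hlt (s : ℝ≥0) (hs : s < t) : (killedValues s : PathSpace E x₀ → _) ⁻¹' A = ∅ := by
    refine Set.eq_empty_of_forall_notMem fun ω hω ↦ hω.1 ?_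
    exact if_neg (not_le.2 hs)
  obtain ⟨c, hc, htc⟩ := exists_dyadicTime_eq_grid hj
  rw [← hD, ← ENNReal.toReal_eq_toReal_iff' (measure_ne_top _ _) (measure_ne_top _ _)]
  change (gridLaw m n).real A = (m t).real D
  rw [hm.gridLaw_real n hA]
  have hle (k : ℕ) : t ≤ (k : ℝ≥0) / 2 ^ n ↔ c ≤ k := by
    rw [show t = (c : ℝ≥0) / 2 ^ n from htc, grid_le_grid_iff]
  rcases c with _ | c
  · have h0 : t = 0 := by rw [show t = _ from htc]; simp
    rw [Finset.sum_eq_zero, add_zero, hge 0 h0.le, h0]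
    intro k _
    rw [gridIncrement, hge _ ((hle _).2 (Nat.zero_le _)), hge _ ((hle _).2 (Nat.zero_le _)),
      sub_self]
  · -- the event can only begin to hold at the killing time `t`, so that a single increment remains
    have h0 : 0 < t := by rw [show t = _ from htc]; positivity
    rw [hlt 0 h0, measureReal_empty, zero_add, Finset.sum_eq_single_of_mem c]
    · rw [gridIncrement, hge _ ((hle _).2 le_rfl), hlt _ (not_le.1 fun h ↦ by
        have := (hle _).1 h; omega), measureReal_empty, sub_zero, ← htc]
    · exact Finset.mem_range.2 (by omega)
    · intro k _ hk
      rw [gridIncrement]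
      rcases lt_or_gt_of_ne hk with h | h
      · rw [hlt _ (not_le.1 fun h' ↦ by have := (hle _).1 h'; omega),
          hlt _ (not_le.1 fun h' ↦ by have := (hle _).1 h'; omega)]
        simp
      · rw [hge _ ((hle _).2 (by omega)), hge _ ((hle _).2 (by omega)), sub_self]

end

lemma measure_eq_of_forall_map_frestrictLe {X : Type*} [MeasurableSpace X]
    {μ ν : Measure (ℕ → X)} [IsFiniteMeasure ν] (j : ℕ)
    (h : ∀ n, j ≤ n → μ.map (Preorder.frestrictLe n) = ν.map (Preorder.frestrictLe n)) :
    μ = ν := by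
  have hfam : IsProjectiveMeasureFamily (α := fun _ ↦ X) fun I : Finset ℕ ↦
      ν.map (Finset.restrict (π := fun _ ↦ X) I) := by
    intro I J hJI
    rw [Measure.map_map (Finset.measurable_restrict₂ hJI) (Finset.measurable_restrict I)]
    rfl
  have hμ := (isProjectiveLimit_nat_iff' hfam μ j).2 fun n hn ↦ h n hn
  have hν := (isProjectiveLimit_nat_iff' hfam ν j).2 fun n _ ↦ rfl
  exact hμ.unique hν

/-- The law, on the dyadic times, of a process whose survival is governed by `m`. -/
theorem IsSurvivalFamily.exists_law {E : Type*} [TopologicalSpace E] [PolishSpace E]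
    [MeasurableSpace E] [BorelSpace E] {x₀ : E} {m : ℝ≥0 → Measure (PathSpace E x₀)}
    (hm : IsSurvivalFamily m) :
    ∃ μ : Measure (ℕ → WithCemetery E), IsProbabilityMeasure μ ∧
      ∀ j B, MeasurableSet B → μ {x | x j ≠ cemetery ∧ killAfter (dyadicTime j) x ∈ B} =
        m (dyadicTime j) (killedValues (dyadicTime j) ⁻¹' B) := by
  have := hm.isFinite
  have := hm.isProbabilityMeasure_gridLaw
  have : Nonempty (WithCemetery E) := ⟨cemetery⟩
  obtain ⟨μ, hμ, hμn⟩ := exists_measure_map_frestrictLe (X := fun _ ↦ WithCemetery E)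
    (gridLaw m) hm.gridLaw_succ
  refine ⟨μ, hμ, fun j B hB ↦ ?_⟩
  have key : (μ.restrict {x | x j ≠ cemetery}).map (killAfter (dyadicTime j)) =
      (m (dyadicTime j)).map (killedValues (dyadicTime j)) := by
    refine measure_eq_of_forall_map_frestrictLe j fun n hn ↦ ?_
    ext C hC
    have hC' := Preorder.measurable_frestrictLe (X := fun _ ↦ WithCemetery E) n hC
    rw [Measure.map_apply (by fun_prop) hC, Measure.map_apply (by fun_prop) hC,
      Measure.map_apply (measurable_killAfter _) hC',
      Measure.map_apply (measurable_killedValues _) hC',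
      Measure.restrict_apply (measurable_killAfter _ hC'), ← hm.gridLaw_alive hn hC']
    -- the event depends on the first `n + 1` coordinates only
    let D : Set (∀ _ : Finset.Iic n, WithCemetery E) :=
      {y | y ⟨j, Finset.mem_Iic.2 hn⟩ ≠ cemetery ∧
        (fun i : Finset.Iic n ↦ if dyadicTime i ≤ dyadicTime j then y i else cemetery) ∈ C}
    have hD : MeasurableSet D := by
      refine MeasurableSet.inter ?_ (measurableSet_preimage (measurable_pi_iff.2 fun i ↦ ?_) hC)
      · have h1 : MeasurableSet ({cemetery}ᶜ : Set (WithCemetery E)) :=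
          isOpen_cemetery.measurableSet.compl
        exact (measurable_pi_apply (⟨j, Finset.mem_Iic.2 hn⟩ : Finset.Iic n) :
          Measurable fun y : (∀ _ : Finset.Iic n, WithCemetery E) ↦ y _) h1
      · split_ifs
        · exact measurable_pi_apply _
        · exact measurable_const
    have h2 := DFunLike.congr_fun (hμn n) D
    rw [Measure.map_apply (by fun_prop) hD, Measure.map_apply (by fun_prop) hD] at h2
    rw [Set.inter_comm]
    exact h2
  have := DFunLike.congr_fun key B
  rw [Measure.map_apply (measurable_killAfter _) hB,
    Measure.map_apply (measurable_killedValues _) hB,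
    Measure.restrict_apply (measurable_killAfter _ hB), Set.inter_comm] at this
  exact this

/-! ### The exit measure of a survival family -/

section

variable {E : Type*} [TopologicalSpace E] [PolishSpace E] [MeasurableSpace E] [BorelSpace E]
  {x₀ : E} {m : ℝ≥0 → Measure (PathSpace E x₀)} {μ : Measure (ℕ → WithCemetery E)}

/-- Under the law of a survival family almost all values are those of a path, because irregularity
up to a time at which the path is alive is an event governed by the survival family. -/
lemma IsSurvivalFamily.ae_regularValues (hm : IsSurvivalFamily m) [IsProbabilityMeasure μ]
    (hμ : ∀ j B, MeasurableSet B → μ {x | x j ≠ cemetery ∧ killAfter (dyadicTime j) x ∈ B} =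
      m (dyadicTime j) (killedValues (dyadicTime j) ⁻¹' B))
    (hlim : Tendsto (fun i ↦ m (dyadicTime i) Set.univ) (rightFilter 0) (𝓝 1)) :
    ∀ᵐ x ∂μ, RegularValues x₀ x := by
  have halive (j : ℕ) : μ {x | x j ≠ cemetery} = m (dyadicTime j) Set.univ := by
    simpa using hμ j Set.univ MeasurableSet.univ
  refine Filter.Eventually.and ?_ (ae_all_iff.2 fun j ↦ ?_)
  · have hN : MeasurableSet {x : ℕ → WithCemetery E | ∃ j, 0 < dyadicTime j ∧ x j ≠ cemetery} := by
      rw [Set.ofPred_exists]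
      exact MeasurableSet.iUnion fun j ↦ (MeasurableSet.const _).inter (measurableSet_ne_cemetery j)
    refine (prob_compl_eq_zero_iff hN).2 (le_antisymm prob_le_one ?_)
    refine le_of_tendsto hlim ?_
    filter_upwards [eventually_rightFilter zero_lt_one] with i hi
    rw [← halive]
    exact measure_mono fun x hx ↦ ⟨i, hi.1, hx⟩
  · let B : Set (ℕ → WithCemetery E) := {y | ¬ RegularUpTo x₀ (dyadicTime j) (stopAt j y)}
    have hB : MeasurableSet B :=
      (measurable_stopAt j (measurableSet_regularUpTo x₀ (dyadicTime j))).compl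
    have h0 : m (dyadicTime j) (killedValues (dyadicTime j) ⁻¹' B) = 0 := by
      refine measure_mono_null (fun ω hω ↦ ?_) (hm.alive (dyadicTime j))
      by_contra hc
      refine hω ?_
      rw [killedValues, stopAt_killAfter le_rfl]
      exact regularUpTo_stopAt_dyadicValues ω hc
    rw [← hμ j B hB] at h0
    refine measure_mono_null (fun x hx ↦ ?_) h0
    have hx' : ¬ (x j ≠ cemetery → RegularUpTo x₀ (dyadicTime j) (stopAt j x)) := hx
    rw [Classical.not_imp] at hx'
    refine ⟨hx'.1, ?_⟩
    change ¬ RegularUpTo x₀ (dyadicTime j) (stopAt j (killAfter (dyadicTime j) x))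
    rw [stopAt_killAfter le_rfl]
    exact hx'.2

/-- The law of a survival family, read on the path space, before a dyadic time at which the path is
alive. -/
lemma IsSurvivalFamily.measure_alive_inter_toPath (hm : IsSurvivalFamily m)
    (hμ : ∀ j B, MeasurableSet B → μ {x | x j ≠ cemetery ∧ killAfter (dyadicTime j) x ∈ B} =
      m (dyadicTime j) (killedValues (dyadicTime j) ⁻¹' B))
    (hreg : ∀ᵐ x ∂μ, RegularValues x₀ x) {t : ℝ≥0} {j : ℕ} (htj : t < dyadicTime j)
    {A : Set (PathSpace E x₀)} (hA : MeasurableSet[naturalFiltration E x₀ t] A) :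
    μ {x | x j ≠ cemetery ∧ toPath x₀ x ∈ A} = m (dyadicTime j) A := by
  have hA' : MeasurableSet A := (naturalFiltration E x₀).le t _ hA
  have hiff {x : ℕ → WithCemetery E} (hx : RegularValues x₀ x) (hj : x j ≠ cemetery) :
      toPath x₀ (killAfter (dyadicTime j) x) ∈ A ↔ toPath x₀ x ∈ A :=
    mem_iff_of_eqOn hA fun s hs ↦ toPath_killAfter hx hj (hs.trans_lt htj)
  have h1 : μ {x | x j ≠ cemetery ∧ toPath x₀ x ∈ A} =
      μ {x | x j ≠ cemetery ∧ killAfter (dyadicTime j) x ∈ toPath x₀ ⁻¹' A} := by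
    refine measure_congr ?_
    filter_upwards [hreg] with x hx
    exact propext (and_congr_right fun hj ↦ (hiff hx hj).symm)
  rw [h1, hμ j _ (measurable_toPath x₀ hA')]
  refine measure_congr ?_
  have halive : ∀ᵐ ω ∂m (dyadicTime j), ω.toFun (dyadicTime j) ≠ cemetery :=
    measure_mono_null (fun ω h ↦ not_not.1 h) (hm.alive (dyadicTime j))
  filter_upwards [halive] with ω hω
  have := hiff (regularValues_dyadicValues ω) hω
  rw [toPath_dyadicValues] at this
  exact propext this

/-- Existence of a measure for which the survival probabilities are given by a right-continuous
survival family. -/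
theorem IsSurvivalFamily.exists_measure (hm : IsSurvivalFamily m)
    (hlim : ∀ t A, MeasurableSet[filtrationPlus E x₀ t] A →
      Tendsto (fun i ↦ m (dyadicTime i) A) (rightFilter t) (𝓝 (m t A))) :
    ∃ Q : Measure (PathSpace E x₀), IsProbabilityMeasure Q ∧
      ∀ t A, MeasurableSet[filtrationPlus E x₀ t] A →
        Q (A ∩ {ω | (t : WithTop ℝ≥0) < lifetime ω}) = m t A := by
  obtain ⟨μ, hprob, hμ⟩ := hm.exists_law
  have hreg := hm.ae_regularValues hμ (hm.zero ▸ hlim 0 Set.univ MeasurableSet.univ)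
  have hmeas := measurable_toPath x₀
  refine ⟨μ.map (toPath x₀), Measure.isProbabilityMeasure_map hmeas.aemeasurable,
    fun t A hA ↦ ?_⟩
  have hA' : MeasurableSet A := (filtrationPlus E x₀).le t _ hA
  have hT : MeasurableSet (A ∩ {ω | (t : WithTop ℝ≥0) < lifetime ω}) :=
    hA'.inter ((naturalFiltration E x₀).le t _ (measurableSet_lt_lifetime t))
  rw [Measure.map_apply hmeas hT]
  refine tendsto_nhds_unique (f := fun i ↦ μ {x | x i ≠ cemetery ∧ toPath x₀ x ∈ A})
    (l := rightFilter t) ?_ ?_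
  · refine tendsto_measure_of_ae_tendsto_indicator_of_isFiniteMeasure _ (hmeas hT)
      (fun i ↦ (measurableSet_ne_cemetery i).inter (hmeas hA')) ?_
    filter_upwards [hreg] with x hx
    by_cases h : ∃ j, t < dyadicTime j ∧ x j ≠ cemetery
    · obtain ⟨j, hj, hj'⟩ := h
      filter_upwards [eventually_rightFilter hj] with i hi
      have hi' := hx.ne_cemetery_of_le hi.2.le hj'
      have hlt := (lt_lifetime_toPath_iff hx t).2 ⟨j, hj, hj'⟩
      exact ⟨fun h ↦ ⟨h.2, hlt⟩, fun h ↦ ⟨hi', h.1⟩⟩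
    · filter_upwards [eventually_rightFilter (lt_add_one t)] with i hi
      exact ⟨fun h' ↦ absurd ⟨i, hi.1, h'.1⟩ h,
        fun h' ↦ absurd ((lt_lifetime_toPath_iff hx t).1 h'.2) h⟩
  · refine (hlim t A hA).congr' ?_
    filter_upwards [eventually_rightFilter (lt_add_one t)] with i hi
    obtain ⟨u, hu, hui⟩ := exists_between hi.1
    exact (hm.measure_alive_inter_toPath hμ hreg hui (filtrationPlus_le hu A hA)).symm

end

/-! ### The survival family of a supermartingale -/

section

variable {E : Type*} [TopologicalSpace E] [MeasurableSpace E] {x₀ : E}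
  {P : Measure (PathSpace E x₀)} {Y : ℝ≥0 → PathSpace E x₀ → ℝ}

/-- The measure with density `Y t` with respect to `P`. -/
def densityFamily (Y : ℝ≥0 → PathSpace E x₀ → ℝ) (P : Measure (PathSpace E x₀)) (t : ℝ≥0) :
    Measure (PathSpace E x₀) :=
  P.withDensity fun ω ↦ ENNReal.ofReal (Y t ω)

lemma densityFamily_apply (t : ℝ≥0) {A : Set (PathSpace E x₀)} (hA : MeasurableSet A) :
    densityFamily Y P t A = ∫⁻ ω in A, ENNReal.ofReal (Y t ω) ∂P :=
  withDensity_apply _ hA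

lemma densityFamily_anti [IsFiniteMeasure P]
    (hY : Supermartingale Y (filtrationPlus E x₀) P) (hpos : ∀ᵐ ω ∂P, ∀ t, 0 < Y t ω)
    {s t : ℝ≥0} (hst : s ≤ t) {A : Set (PathSpace E x₀)}
    (hA : MeasurableSet[filtrationPlus E x₀ s] A) :
    densityFamily Y P t A ≤ densityFamily Y P s A := by
  have hA' : MeasurableSet A := (filtrationPlus E x₀).le s _ hA
  have hnn (u : ℝ≥0) : 0 ≤ᵐ[P.restrict A] Y u :=
    ae_restrict_of_ae (hpos.mono fun ω h ↦ (h u).le)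
  rw [densityFamily_apply _ hA', densityFamily_apply _ hA',
    ← ofReal_integral_eq_lintegral_ofReal (hY.integrable t).integrableOn (hnn t),
    ← ofReal_integral_eq_lintegral_ofReal (hY.integrable s).integrableOn (hnn s)]
  exact ENNReal.ofReal_le_ofReal (hY.setIntegral_le hst hA)

lemma isSurvivalFamily_densityFamily [IsFiniteMeasure P]
    (hP : ∀ᵐ ω ∂P, lifetime ω = ⊤) (hY : Supermartingale Y (filtrationPlus E x₀) P)
    (hpos : ∀ᵐ ω ∂P, ∀ t, 0 < Y t ω) (hzero : ∫ ω, Y 0 ω ∂P = 1) :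
    IsSurvivalFamily (densityFamily Y P) where
  isFinite t := isFiniteMeasure_withDensity_ofReal (hY.integrable t).2
  zero := by
    rw [densityFamily_apply _ MeasurableSet.univ, Measure.restrict_univ,
      ← ofReal_integral_eq_lintegral_ofReal (hY.integrable 0) (hpos.mono fun ω h ↦ (h 0).le),
      hzero, ENNReal.ofReal_one]
  anti s t hst A hA := densityFamily_anti hY hpos hst (naturalFiltration_le_filtrationPlus s A hA)
  alive t := by
    refine withDensity_absolutelyContinuous _ _ ?_
    exact measure_mono_null (fun ω hω h ↦ toFun_ne_cemetery_of_lifetime_eq_top h t hω)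
      (ae_iff.1 hP)

/-- Right-continuity of the measures `Y t · P`: Fatou's lemma gives one inequality and the
supermartingale property the other. -/
lemma tendsto_densityFamily [IsFiniteMeasure P]
    (hY : Supermartingale Y (filtrationPlus E x₀) P)
    (hcad : ∀ᵐ ω ∂P, IsCadlagPath fun t ↦ Y t ω) (hpos : ∀ᵐ ω ∂P, ∀ t, 0 < Y t ω)
    {t : ℝ≥0} {A : Set (PathSpace E x₀)} (hA : MeasurableSet[filtrationPlus E x₀ t] A) :
    Tendsto (fun i ↦ densityFamily Y P (dyadicTime i) A) (rightFilter t)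
      (𝓝 (densityFamily Y P t A)) := by
  have hA' : MeasurableSet A := (filtrationPlus E x₀).le t _ hA
  refine tendsto_of_le_liminf_of_limsup_le ?_ ?_
  · calc densityFamily Y P t A = ∫⁻ ω in A, ENNReal.ofReal (Y t ω) ∂P := densityFamily_apply _ hA'
      _ ≤ ∫⁻ ω in A, liminf (fun i ↦ ENNReal.ofReal (Y (dyadicTime i) ω)) (rightFilter t) ∂P := by
          refine lintegral_mono_ae (ae_restrict_of_ae ?_)
          filter_upwards [hcad] with ω hω
          have h1 : Tendsto (fun s ↦ Y s ω) (𝓝[>] t) (𝓝 (Y t ω)) :=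
            (hω t).1.mono_left (nhdsWithin_mono _ Set.Ioi_subset_Ici_self)
          have h2 : Tendsto (fun i ↦ ENNReal.ofReal (Y (dyadicTime i) ω)) (rightFilter t) _ :=
            ENNReal.tendsto_ofReal (h1.comp tendsto_comap)
          exact h2.liminf_eq.ge
      _ ≤ liminf (fun i ↦ ∫⁻ ω in A, ENNReal.ofReal (Y (dyadicTime i) ω) ∂P) (rightFilter t) :=
          lintegral_liminf_le fun n ↦ ENNReal.measurable_ofReal.comp
            (((hY.stronglyMeasurable _).mono ((filtrationPlus E x₀).le _)).measurable)
      _ = liminf (fun i ↦ densityFamily Y P (dyadicTime i) A) (rightFilter t) := by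
          simp only [densityFamily_apply _ hA']
  · refine limsup_le_of_le (by isBoundedDefault) ?_
    filter_upwards [eventually_rightFilter (lt_add_one t)] with i hi
    exact densityFamily_anti hY hpos hi.1.le hA

end

/-! ### From deterministic times to stopping times -/

/-- The smallest grid point of mesh `2⁻ⁿ` strictly greater than `θ`. -/
def dyadicUpper (n : ℕ) (θ : ℝ≥0) : ℝ≥0 := ((⌊θ * 2 ^ n⌋₊ + 1 : ℕ) : ℝ≥0) / 2 ^ n

lemma lt_dyadicUpper (n : ℕ) (θ : ℝ≥0) : θ < dyadicUpper n θ := by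
  rw [dyadicUpper, lt_div_iff₀ (by positivity)]
  exact_mod_cast Nat.lt_floor_add_one (θ * 2 ^ n)

lemma dyadicUpper_le (n : ℕ) (θ : ℝ≥0) : dyadicUpper n θ ≤ θ + 2⁻¹ ^ n := by
  calc dyadicUpper n θ ≤ (θ * 2 ^ n + 1) / 2 ^ n := by
        unfold dyadicUpper
        gcongr
        push_cast
        gcongr
        exact Nat.floor_le (by positivity)
    _ = θ + 2⁻¹ ^ n := by
        rw [inv_pow, add_div, mul_div_cancel_right₀ _ (by positivity), one_div]

lemma tendsto_dyadicUpper (θ : ℝ≥0) :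
    Tendsto (fun n ↦ dyadicUpper n θ) atTop (𝓝[>] θ) := by
  refine tendsto_nhdsWithin_iff.2 ⟨?_, Eventually.of_forall fun n ↦ lt_dyadicUpper n θ⟩
  have h : Tendsto (fun n : ℕ ↦ θ + (2⁻¹ : ℝ≥0) ^ n) atTop (𝓝 (θ + 0)) :=
    tendsto_const_nhds.add (tendsto_pow_atTop_nhds_zero_of_lt_one zero_le
      (NNReal.inv_lt_one_iff (by norm_num) |>.2 (by norm_num)))
  rw [add_zero] at h
  exact tendsto_of_tendsto_of_tendsto_of_le_of_le tendsto_const_nhds h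
    (fun n ↦ (lt_dyadicUpper n θ).le) (fun n ↦ dyadicUpper_le n θ)

lemma exists_dyadicTime_between_withTop {θ : ℝ≥0} {z : WithTop ℝ≥0} (h : (θ : WithTop ℝ≥0) < z) :
    ∃ j, θ < dyadicTime j ∧ (dyadicTime j : WithTop ℝ≥0) < z := by
  cases z with
  | top =>
    obtain ⟨j, hj, -⟩ := exists_dyadicTime_between (lt_add_one θ)
    exact ⟨j, hj, WithTop.coe_lt_top _⟩
  | coe z =>
    obtain ⟨j, hj, hj'⟩ := exists_dyadicTime_between (WithTop.coe_lt_coe.1 h)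
    exact ⟨j, hj, WithTop.coe_lt_coe.2 hj'⟩

section

variable {E : Type*} [TopologicalSpace E] {x₀ : E}
  {Y : ℝ≥0 → PathSpace E x₀ → ℝ}
  {τ : PathSpace E x₀ → WithTop ℝ≥0}

/-- The event that `τ` lies in the `k`-th grid interval `[k / 2ⁿ, (k + 1) / 2ⁿ)`. -/
def stopCell (τ : PathSpace E x₀ → WithTop ℝ≥0) (n k : ℕ) : Set (PathSpace E x₀) :=
  {ω | τ ω < (((k + 1 : ℕ) / 2 ^ n : ℝ≥0) : WithTop ℝ≥0)} \
    {ω | τ ω < ((k / 2 ^ n : ℝ≥0) : WithTop ℝ≥0)}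

/-- The value of `Y` at the grid point following `τ`. -/
def upperValue (Y : ℝ≥0 → PathSpace E x₀ → ℝ) (τ : PathSpace E x₀ → WithTop ℝ≥0) (n : ℕ)
    (ω : PathSpace E x₀) : ℝ :=
  Y (dyadicUpper n (τ ω).untopA) ω

lemma mem_stopCell_iff {n k : ℕ} {ω : PathSpace E x₀} {θ : ℝ≥0} (h : τ ω = θ) :
    ω ∈ stopCell τ n k ↔ ⌊θ * 2 ^ n⌋₊ = k := by
  have h2 : (0 : ℝ≥0) < 2 ^ n := by positivity
  simp only [stopCell, Set.mem_sdiff, Set.mem_ofPred_eq, h, WithTop.coe_lt_coe, not_lt]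
  rw [lt_div_iff₀ h2, div_le_iff₀ h2, Nat.floor_eq_iff (by positivity), and_comm]
  push_cast
  rfl

lemma iUnion_stopCell (n : ℕ) : ⋃ k, stopCell τ n k = {ω | τ ω ≠ ⊤} := by
  ext ω
  rw [Set.mem_iUnion, Set.mem_ofPred_eq]
  constructor
  · rintro ⟨k, hk, -⟩
    exact ne_top_of_lt (show τ ω < _ from hk)
  · intro h
    obtain ⟨θ, hθ⟩ := WithTop.ne_top_iff_exists.1 h
    exact ⟨_, (mem_stopCell_iff hθ.symm).2 rfl⟩

lemma pairwise_disjoint_stopCell (n : ℕ) : Pairwise (Function.onFun Disjoint (stopCell τ n)) := by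
  intro k l hkl
  refine Set.disjoint_left.2 fun ω hk hl ↦ hkl ?_
  obtain ⟨θ, hθ⟩ := WithTop.ne_top_iff_exists.1 (ne_top_of_lt (show τ ω < _ from hk.1))
  rw [← (mem_stopCell_iff hθ.symm).1 hk, (mem_stopCell_iff hθ.symm).1 hl]

lemma dyadicUpper_of_mem_stopCell {n k : ℕ} {ω : PathSpace E x₀} (h : ω ∈ stopCell τ n k) :
    dyadicUpper n (τ ω).untopA = ((k + 1 : ℕ) : ℝ≥0) / 2 ^ n := by
  obtain ⟨θ, hθ⟩ := WithTop.ne_top_iff_exists.1 (ne_top_of_lt (show τ ω < _ from h.1))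
  rw [← (mem_stopCell_iff hθ.symm).1 h, ← hθ]
  rfl

lemma upperValue_of_mem_stopCell {n k : ℕ} {ω : PathSpace E x₀} (h : ω ∈ stopCell τ n k) :
    upperValue Y τ n ω = Y (((k + 1 : ℕ) : ℝ≥0) / 2 ^ n) ω := by
  rw [upperValue, dyadicUpper_of_mem_stopCell h]

lemma tendsto_upperValue {ω : PathSpace E x₀} (hω : IsCadlagPath fun t ↦ Y t ω) :
    Tendsto (fun n ↦ upperValue Y τ n ω) atTop (𝓝 (stoppedValue Y τ ω)) :=
  ((hω (τ ω).untopA).1.mono_left (nhdsWithin_mono _ Set.Ioi_subset_Ici_self)).comp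
    (tendsto_dyadicUpper _)

/-- The event that `τ` is finite and that the values of `Y` immediately after `τ` (along the
grids) are bounded by `c`. It is determined by the path up to just after `τ`. -/
def boundedAfter (Y : ℝ≥0 → PathSpace E x₀ → ℝ) (τ : PathSpace E x₀ → WithTop ℝ≥0) (c : ℕ) :
    Set (PathSpace E x₀) :=
  {ω | τ ω ≠ ⊤ ∧ ∀ᶠ n in atTop, upperValue Y τ n ω ≤ c}

variable [MeasurableSpace E] {P Q : Measure (PathSpace E x₀)}

lemma measurableSet_stopCell (hτ : IsStoppingTime (filtrationPlus E x₀) τ) (n k : ℕ) :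
    MeasurableSet[filtrationPlus E x₀ ((k + 1 : ℕ) / 2 ^ n)] (stopCell τ n k) :=
  (hτ.measurableSet_lt _).diff
    ((filtrationPlus E x₀).mono (grid_le_grid_iff.2 k.le_succ) _ (hτ.measurableSet_lt _))

lemma measurableSet_ne_top (hτ : IsStoppingTime (filtrationPlus E x₀) τ) :
    MeasurableSet {ω | τ ω ≠ ⊤} := by
  rw [← iUnion_stopCell 0]
  exact MeasurableSet.iUnion fun k ↦ (filtrationPlus E x₀).le _ _ (measurableSet_stopCell hτ 0 k)

/-- An event determined by the path up to just after `τ`, seen at the grid points. -/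
lemma measurableSet_inter_stopCell (hτ : IsStoppingTime (filtrationPlus E x₀) τ)
    {B : Set (PathSpace E x₀)}
    (hB : ∀ s : ℝ≥0, MeasurableSet[filtrationPlus E x₀ s] (B ∩ {ω | τ ω < s})) (n k : ℕ) :
    MeasurableSet[filtrationPlus E x₀ ((k + 1 : ℕ) / 2 ^ n)] (B ∩ stopCell τ n k) := by
  rw [stopCell, ← Set.inter_sdiff_assoc]
  exact (hB _).diff
    ((filtrationPlus E x₀).mono (grid_le_grid_iff.2 k.le_succ) _ (hτ.measurableSet_lt _))

lemma measurable_indicator_upperValue (hY : StronglyAdapted (filtrationPlus E x₀) Y)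
    (hτ : IsStoppingTime (filtrationPlus E x₀) τ) (n : ℕ) :
    Measurable ({ω | τ ω ≠ ⊤}.indicator (upperValue Y τ n)) := by
  have h : {ω | τ ω ≠ ⊤}.indicator (upperValue Y τ n) = fun ω ↦
      ∑' k, (stopCell τ n k).indicator (Y (((k + 1 : ℕ) : ℝ≥0) / 2 ^ n)) ω := by
    funext ω
    by_cases hω : τ ω = ⊤
    · rw [Set.indicator_of_notMem (by simpa using hω)]
      symm
      convert! tsum_zero with k
      refine Set.indicator_of_notMem (fun hk ↦ ?_) _
      exact absurd hω (ne_top_of_lt (show τ ω < _ from hk.1))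
    · rw [Set.indicator_of_mem (by simpa using hω)]
      have h' : ω ∈ ⋃ k, stopCell τ n k := by rw [iUnion_stopCell]; exact hω
      obtain ⟨k, hk⟩ := Set.mem_iUnion.1 h'
      rw [tsum_eq_single k, Set.indicator_of_mem hk, upperValue_of_mem_stopCell hk]
      intro l hl
      exact Set.indicator_of_notMem
        (fun hl' ↦ Set.disjoint_left.1 (pairwise_disjoint_stopCell n hl) hl' hk) _
  rw [h]
  refine Measurable.tsum fun k ↦ Measurable.indicator ?_ ?_
  · exact ((hY _).mono ((filtrationPlus E x₀).le _)).measurable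
  · exact (filtrationPlus E x₀).le _ _ (measurableSet_stopCell hτ n k)

/-- The density formula at the grid point following `τ`. -/
lemma measure_lt_lifetime_dyadicUpper
    (hQ : ∀ t A, MeasurableSet[filtrationPlus E x₀ t] A →
      Q (A ∩ {ω | (t : WithTop ℝ≥0) < lifetime ω}) = ∫⁻ ω in A, ENNReal.ofReal (Y t ω) ∂P)
    (n : ℕ) {B : Set (PathSpace E x₀)}
    (hB : ∀ k : ℕ, MeasurableSet[filtrationPlus E x₀ ((k + 1 : ℕ) / 2 ^ n)] (B ∩ stopCell τ n k)) :
    Q {ω | ω ∈ B ∧ τ ω ≠ ⊤ ∧ (dyadicUpper n (τ ω).untopA : WithTop ℝ≥0) < lifetime ω} =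
      ∫⁻ ω in B ∩ {ω | τ ω ≠ ⊤}, ENNReal.ofReal (upperValue Y τ n ω) ∂P := by
  have hdisj : Pairwise (Function.onFun Disjoint fun k ↦ B ∩ stopCell τ n k) := fun k l hkl ↦
    (pairwise_disjoint_stopCell n hkl).mono Set.inter_subset_right Set.inter_subset_right
  have hset : {ω | ω ∈ B ∧ τ ω ≠ ⊤ ∧ (dyadicUpper n (τ ω).untopA : WithTop ℝ≥0) < lifetime ω} =
      ⋃ k : ℕ, (B ∩ stopCell τ n k) ∩
        {ω | (((k + 1 : ℕ) / 2 ^ n : ℝ≥0) : WithTop ℝ≥0) < lifetime ω} := by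
    ext ω
    simp only [Set.mem_ofPred_eq, Set.mem_iUnion, Set.mem_inter_iff]
    constructor
    · rintro ⟨h1, h2, h3⟩
      have h' : ω ∈ ⋃ k, stopCell τ n k := by rw [iUnion_stopCell]; exact h2
      obtain ⟨k, hk⟩ := Set.mem_iUnion.1 h'
      rw [dyadicUpper_of_mem_stopCell hk] at h3
      exact ⟨k, ⟨h1, hk⟩, h3⟩
    · rintro ⟨k, ⟨h1, hk⟩, h3⟩
      rw [dyadicUpper_of_mem_stopCell hk]
      exact ⟨h1, ne_top_of_lt (show τ ω < _ from hk.1), h3⟩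
  rw [hset, measure_iUnion (fun k l hkl ↦ (hdisj hkl).mono Set.inter_subset_left
    Set.inter_subset_left) fun k ↦ ((filtrationPlus E x₀).le _ _ (hB k)).inter
      ((naturalFiltration E x₀).le _ _ (measurableSet_lt_lifetime _)),
    ← iUnion_stopCell n, Set.inter_iUnion,
    lintegral_iUnion (fun k ↦ (filtrationPlus E x₀).le _ _ (hB k)) hdisj]
  refine tsum_congr fun k ↦ ?_
  rw [hQ _ _ (hB k)]
  refine setLIntegral_congr_fun ((filtrationPlus E x₀).le _ _ (hB k)) fun ω hω ↦ ?_
  simp only [upperValue_of_mem_stopCell hω.2]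

lemma measurableSet_boundedAfter_inter (hY : StronglyAdapted (filtrationPlus E x₀) Y)
    (hτ : IsStoppingTime (filtrationPlus E x₀) τ) (c : ℕ) (s : ℝ≥0) :
    MeasurableSet[filtrationPlus E x₀ s] (boundedAfter Y τ c ∩ {ω | τ ω < s}) := by
  -- before `s`, the values at the grid points following `τ` are eventually those of `U n`
  let U : ℕ → PathSpace E x₀ → ℝ := fun n ω ↦
    ∑ k ∈ Finset.range ⌊s * 2 ^ n⌋₊, (stopCell τ n k).indicator (Y (((k + 1 : ℕ) : ℝ≥0) / 2 ^ n)) ω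
  have hU (n : ℕ) : Measurable[filtrationPlus E x₀ s] (U n) := by
    refine Finset.measurable_fun_sum _ fun k hk ↦ ?_
    have hks : ((k + 1 : ℕ) : ℝ≥0) / 2 ^ n ≤ s := by
      rw [div_le_iff₀ (by positivity)]
      exact (Nat.cast_le.2 (Finset.mem_range.1 hk)).trans (Nat.floor_le (by positivity))
    exact (((hY _).mono ((filtrationPlus E x₀).mono hks)).measurable).indicator
      ((filtrationPlus E x₀).mono hks _ (measurableSet_stopCell hτ n k))
  have hUV (ω : PathSpace E x₀) (hω : τ ω < s) :
      ∀ᶠ n in atTop, U n ω = upperValue Y τ n ω := by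
    obtain ⟨θ, hθ⟩ := WithTop.ne_top_iff_exists.1 (ne_top_of_lt hω)
    have hθs : θ < s := WithTop.coe_lt_coe.1 (hθ ▸ hω)
    filter_upwards [(tendsto_dyadicUpper θ) (mem_nhdsWithin_of_mem_nhds (Iic_mem_nhds hθs))]
      with n hn
    have hmem : ω ∈ stopCell τ n ⌊θ * 2 ^ n⌋₊ := (mem_stopCell_iff hθ.symm).2 rfl
    rw [upperValue_of_mem_stopCell hmem]
    refine (Finset.sum_eq_single_of_mem ⌊θ * 2 ^ n⌋₊ ?_ fun l _ hl ↦ ?_).trans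
      (Set.indicator_of_mem hmem _)
    · refine Finset.mem_range.2 (Nat.le_floor ?_)
      exact (div_le_iff₀ (by positivity)).1 (show dyadicUpper n θ ≤ s from hn)
    · exact Set.indicator_of_notMem
        (fun hl' ↦ Set.disjoint_left.1 (pairwise_disjoint_stopCell n hl) hl' hmem) _
  have hset : boundedAfter Y τ c ∩ {ω | τ ω < s} =
      (⋃ N, ⋂ n, ⋂ (_ : N ≤ n), {ω | U n ω ≤ c}) ∩ {ω | τ ω < s} := by
    ext ω
    refine and_congr_left fun hω ↦ ?_
    simp only [boundedAfter, Set.mem_ofPred_eq, Set.mem_iUnion, Set.mem_iInter,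
      ← eventually_atTop]
    rw [and_iff_right (ne_top_of_lt (show τ ω < _ from hω))]
    exact eventually_congr ((hUV ω hω).mono fun n hn ↦ by rw [hn])
  rw [hset]
  refine MeasurableSet.inter ?_ (hτ.measurableSet_lt s)
  exact MeasurableSet.iUnion fun N ↦ MeasurableSet.iInter fun n ↦ MeasurableSet.iInter fun _ ↦
    measurableSet_le (hU n) measurable_const

/-- Right after `τ` the process `Y` is bounded, `Q`-almost surely on `{τ < ζ}`. The exceptional
set is `P`-null, and before a dyadic time it is determined by the path up to that time. -/
lemma ae_exists_mem_boundedAfter (hY : StronglyAdapted (filtrationPlus E x₀) Y)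
    (hcad : ∀ᵐ ω ∂P, IsCadlagPath fun t ↦ Y t ω)
    (hQP : ∀ t A, MeasurableSet[filtrationPlus E x₀ t] A → P A = 0 →
      Q (A ∩ {ω | (t : WithTop ℝ≥0) < lifetime ω}) = 0)
    (hτ : IsStoppingTime (filtrationPlus E x₀) τ) :
    ∀ᵐ ω ∂Q, τ ω < lifetime ω → ∃ c, ω ∈ boundedAfter Y τ c := by
  have hnull (j : ℕ) : Q (({ω | τ ω < dyadicTime j} \
      ⋃ c, boundedAfter Y τ c ∩ {ω | τ ω < dyadicTime j}) ∩
        {ω | (dyadicTime j : WithTop ℝ≥0) < lifetime ω}) = 0 := by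
    refine hQP _ _ ((hτ.measurableSet_lt _).diff (MeasurableSet.iUnion fun c ↦
      measurableSet_boundedAfter_inter hY hτ c _)) ?_
    refine measure_mono_null (t := {ω | ¬ IsCadlagPath fun t ↦ Y t ω})
      (fun ω hω hcω ↦ hω.2 ?_) (ae_iff.1 hcad)
    obtain ⟨c, hc⟩ := exists_nat_gt (stoppedValue Y τ ω)
    refine Set.mem_iUnion.2 ⟨c, ⟨ne_top_of_lt (show τ ω < _ from hω.1), ?_⟩, hω.1⟩
    exact ((tendsto_upperValue hcω).eventually_lt_const hc).mono fun n hn ↦ hn.le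
  refine measure_mono_null (fun ω hω ↦ ?_) (measure_iUnion_null hnull)
  have hω' : ¬ (τ ω < lifetime ω → ∃ c, ω ∈ boundedAfter Y τ c) := hω
  rw [Classical.not_imp] at hω'
  obtain ⟨θ, hθ⟩ := WithTop.ne_top_iff_exists.1 (ne_top_of_lt hω'.1)
  obtain ⟨j, hj, hj'⟩ := exists_dyadicTime_between_withTop (hθ ▸ hω'.1)
  refine Set.mem_iUnion.2 ⟨j, ⟨?_, fun h ↦ hω'.2 ?_⟩, hj'⟩
  · change τ ω < _
    rw [← hθ]
    exact WithTop.coe_lt_coe.2 hj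
  · obtain ⟨c, hc⟩ := Set.mem_iUnion.1 h
    exact ⟨c, hc.1⟩

lemma measurableSet_inter_lt (hτ : IsStoppingTime (filtrationPlus E x₀) τ)
    {A : Set (PathSpace E x₀)} (hA : MeasurableSet[hτ.measurableSpace] A) (s : ℝ≥0) :
    MeasurableSet[filtrationPlus E x₀ s] (A ∩ {ω | τ ω < s}) := by
  have h : A ∩ {ω | τ ω < s} = (A ∩ {ω | τ ω ≤ s}) ∩ {ω | τ ω < s} := by
    ext ω
    simp only [Set.mem_inter_iff, Set.mem_ofPred_eq]
    exact ⟨fun h ↦ ⟨⟨h.1, h.2.le⟩, h.2⟩, fun h ↦ ⟨h.1.1, h.2⟩⟩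
  rw [h]
  exact (hA.2 s).inter (hτ.measurableSet_lt s)

end

section

variable {E : Type*} [TopologicalSpace E] [MeasurableSpace E] {x₀ : E}
  {P Q : Measure (PathSpace E x₀)} {Y : ℝ≥0 → PathSpace E x₀ → ℝ}
  {τ : PathSpace E x₀ → WithTop ℝ≥0}

lemma measurable_indicator_ofReal_upperValue (hY : StronglyAdapted (filtrationPlus E x₀) Y)
    (hτ : IsStoppingTime (filtrationPlus E x₀) τ) (n : ℕ) {B : Set (PathSpace E x₀)}
    (hB : MeasurableSet B) (hBτ : B ⊆ {ω | τ ω ≠ ⊤}) :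
    Measurable (B.indicator fun ω ↦ ENNReal.ofReal (upperValue Y τ n ω)) := by
  have h : (B.indicator fun ω ↦ ENNReal.ofReal (upperValue Y τ n ω)) = B.indicator
      fun ω ↦ ENNReal.ofReal ({ω | τ ω ≠ ⊤}.indicator (upperValue Y τ n) ω) := by
    refine Set.indicator_congr fun ω hω ↦ ?_
    rw [Set.indicator_of_mem (hBτ hω)]
  rw [h]
  exact (ENNReal.measurable_ofReal.comp (measurable_indicator_upperValue hY hτ n)).indicator hB

/-- One half of the density formula at a stopping time: Fatou's lemma along the grid points which
decrease to it. -/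
lemma lintegral_stoppedValue_le (hY : StronglyAdapted (filtrationPlus E x₀) Y)
    (hcad : ∀ᵐ ω ∂P, IsCadlagPath fun t ↦ Y t ω)
    (hQ : ∀ t A, MeasurableSet[filtrationPlus E x₀ t] A →
      Q (A ∩ {ω | (t : WithTop ℝ≥0) < lifetime ω}) = ∫⁻ ω in A, ENNReal.ofReal (Y t ω) ∂P)
    (hτ : IsStoppingTime (filtrationPlus E x₀) τ) {A : Set (PathSpace E x₀)}
    (hA : MeasurableSet[hτ.measurableSpace] A) :
    ∫⁻ ω in A ∩ {ω | τ ω ≠ ⊤}, ENNReal.ofReal (stoppedValue Y τ ω) ∂P ≤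
      Q (A ∩ {ω | τ ω < lifetime ω}) := by
  have hA' : MeasurableSet (A ∩ {ω | τ ω ≠ ⊤}) :=
    (hτ.measurableSpace_le A hA).inter (measurableSet_ne_top hτ)
  rw [← lintegral_indicator hA']
  calc ∫⁻ ω, (A ∩ {ω | τ ω ≠ ⊤}).indicator (fun ω ↦ ENNReal.ofReal (stoppedValue Y τ ω)) ω ∂P
      ≤ ∫⁻ ω, liminf (fun n ↦ (A ∩ {ω | τ ω ≠ ⊤}).indicator
          (fun ω ↦ ENNReal.ofReal (upperValue Y τ n ω)) ω) atTop ∂P := by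
        refine lintegral_mono_ae ?_
        filter_upwards [hcad] with ω hω
        by_cases h : ω ∈ A ∩ {ω | τ ω ≠ ⊤}
        · simp only [Set.indicator_of_mem h]
          exact (ENNReal.tendsto_ofReal (tendsto_upperValue hω)).liminf_eq.ge
        · simp only [Set.indicator_of_notMem h]
          exact zero_le
    _ ≤ liminf (fun n ↦ ∫⁻ ω, (A ∩ {ω | τ ω ≠ ⊤}).indicator
          (fun ω ↦ ENNReal.ofReal (upperValue Y τ n ω)) ω ∂P) atTop :=
        lintegral_liminf_le fun n ↦
          measurable_indicator_ofReal_upperValue hY hτ n hA' Set.inter_subset_right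
    _ ≤ Q (A ∩ {ω | τ ω < lifetime ω}) := by
        refine liminf_le_of_le (by isBoundedDefault) fun b hb ↦ ?_
        obtain ⟨n, hn⟩ := hb.exists
        refine hn.trans ?_
        rw [lintegral_indicator hA', ← measure_lt_lifetime_dyadicUpper hQ n
          fun k ↦ measurableSet_inter_stopCell hτ (measurableSet_inter_lt hτ hA) n k]
        refine measure_mono fun ω hω ↦ ⟨hω.1, lt_trans ?_ hω.2.2⟩
        obtain ⟨θ, hθ⟩ := WithTop.ne_top_iff_exists.1 hω.2.1
        rw [← hθ]
        exact WithTop.coe_lt_coe.2 (lt_dyadicUpper n θ)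

/-- The other half of the density formula, on the event that `Y` is bounded right after the
stopping time: there the reverse Fatou lemma applies along the grid points. -/
lemma measure_boundedAfter_le (hY : StronglyAdapted (filtrationPlus E x₀) Y)
    [IsFiniteMeasure P] [IsFiniteMeasure Q]
    (hcad : ∀ᵐ ω ∂P, IsCadlagPath fun t ↦ Y t ω)
    (hQ : ∀ t A, MeasurableSet[filtrationPlus E x₀ t] A →
      Q (A ∩ {ω | (t : WithTop ℝ≥0) < lifetime ω}) = ∫⁻ ω in A, ENNReal.ofReal (Y t ω) ∂P)
    (hτ : IsStoppingTime (filtrationPlus E x₀) τ) {A : Set (PathSpace E x₀)}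
    (hA : MeasurableSet[hτ.measurableSpace] A) (c : ℕ) :
    Q (A ∩ {ω | τ ω < lifetime ω} ∩ boundedAfter Y τ c) ≤
      ∫⁻ ω in A ∩ {ω | τ ω ≠ ⊤}, ENNReal.ofReal (stoppedValue Y τ ω) ∂P := by
  set B : ℕ → Set (PathSpace E x₀) := fun n ↦
    A ∩ boundedAfter Y τ c ∩ {ω | upperValue Y τ n ω ≤ c} with hBdef
  have hAG (n k : ℕ) : MeasurableSet[filtrationPlus E x₀ ((k + 1 : ℕ) / 2 ^ n)]
      (A ∩ boundedAfter Y τ c ∩ stopCell τ n k) := by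
    refine measurableSet_inter_stopCell hτ (fun s ↦ ?_) n k
    rw [Set.inter_inter_distrib_right]
    exact (measurableSet_inter_lt hτ hA s).inter (measurableSet_boundedAfter_inter hY hτ c s)
  have hBk (n k : ℕ) : MeasurableSet[filtrationPlus E x₀ ((k + 1 : ℕ) / 2 ^ n)]
      (B n ∩ stopCell τ n k) := by
    have h : B n ∩ stopCell τ n k = (A ∩ boundedAfter Y τ c ∩ stopCell τ n k) ∩
        {ω | Y (((k + 1 : ℕ) : ℝ≥0) / 2 ^ n) ω ≤ c} := by
      ext ω
      simp only [hBdef, Set.mem_inter_iff, Set.mem_ofPred_eq]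
      constructor
      · rintro ⟨⟨h1, h2⟩, h3⟩
        exact ⟨⟨h1, h3⟩, upperValue_of_mem_stopCell (Y := Y) h3 ▸ h2⟩
      · rintro ⟨⟨h1, h3⟩, h2⟩
        exact ⟨⟨h1, (upperValue_of_mem_stopCell (Y := Y) h3).symm ▸ h2⟩, h3⟩
    rw [h]
    exact (hAG n k).inter (measurableSet_le (hY _).measurable measurable_const)
  have hBτ (n : ℕ) : B n ⊆ {ω | τ ω ≠ ⊤} := fun ω hω ↦ hω.1.2.1
  have hB (n : ℕ) : MeasurableSet (B n) := by
    rw [← Set.inter_eq_left.2 (hBτ n), ← iUnion_stopCell n, Set.inter_iUnion]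
    exact MeasurableSet.iUnion fun k ↦ (filtrationPlus E x₀).le _ _ (hBk n k)
  have hlim : Q (A ∩ {ω | τ ω < lifetime ω} ∩ boundedAfter Y τ c) ≤
      liminf (fun n ↦ ∫⁻ ω in B n, ENNReal.ofReal (upperValue Y τ n ω) ∂P) atTop := by
    calc Q (A ∩ {ω | τ ω < lifetime ω} ∩ boundedAfter Y τ c)
        ≤ Q (⋃ N, ⋂ n ≥ N, {ω | ω ∈ B n ∧ τ ω ≠ ⊤ ∧
            (dyadicUpper n (τ ω).untopA : WithTop ℝ≥0) < lifetime ω}) := by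
          refine measure_mono fun ω ⟨⟨hωA, hωζ⟩, hωG⟩ ↦ ?_
          obtain ⟨θ, hθ⟩ := WithTop.ne_top_iff_exists.1 hωG.1
          obtain ⟨j, hj, hj'⟩ := exists_dyadicTime_between_withTop
            (show (θ : WithTop ℝ≥0) < lifetime ω from hθ ▸ hωζ)
          have h1 := (tendsto_dyadicUpper θ) (mem_nhdsWithin_of_mem_nhds (Iio_mem_nhds hj))
          obtain ⟨N, hN⟩ := eventually_atTop.1 (hωG.2.and h1)
          refine Set.mem_iUnion.2 ⟨N, Set.mem_iInter₂.2 fun n hn ↦ ?_⟩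
          refine ⟨⟨⟨hωA, hωG⟩, (hN n hn).1⟩, hωG.1, ?_⟩
          rw [← hθ]
          exact (WithTop.coe_lt_coe.2 (hN n hn).2).trans hj'
      _ ≤ liminf (fun n ↦ Q {ω | ω ∈ B n ∧ τ ω ≠ ⊤ ∧
            (dyadicUpper n (τ ω).untopA : WithTop ℝ≥0) < lifetime ω}) atTop := by
          rw [Monotone.measure_iUnion, liminf_eq_iSup_iInf_of_nat]
          · exact iSup_mono fun N ↦ le_iInf₂ fun n hn ↦ measure_mono (Set.biInter_subset_of_mem hn)
          · intro N M hNM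
            exact Set.biInter_subset_biInter_left fun n hn ↦ hNM.trans hn
      _ = _ := by
          congr 1
          funext n
          rw [measure_lt_lifetime_dyadicUpper hQ n (hBk n), Set.inter_eq_left.2 (hBτ n)]
  refine hlim.trans ((liminf_le_limsup).trans ?_)
  simp only [← lintegral_indicator (hB _)]
  refine (limsup_lintegral_le (fun _ ↦ (c : ℝ≥0∞))
    (fun n ↦ measurable_indicator_ofReal_upperValue hY hτ n (hB n) (hBτ n))
    (fun n ↦ ae_of_all _ fun ω ↦ ?_) ?_).trans ?_
  · refine Set.indicator_apply_le' (fun hω ↦ ?_) fun _ ↦ zero_le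
    exact (ENNReal.ofReal_le_ofReal hω.2).trans (by simp)
  · rw [lintegral_const]
    exact ENNReal.mul_ne_top (ENNReal.natCast_ne_top c) (measure_ne_top _ _)
  · rw [← lintegral_indicator ((hτ.measurableSpace_le A hA).inter (measurableSet_ne_top hτ))]
    refine lintegral_mono_ae ?_
    filter_upwards [hcad] with ω hω
    by_cases h : ω ∈ A ∩ {ω | τ ω ≠ ⊤}
    · rw [Set.indicator_of_mem h, ← (ENNReal.tendsto_ofReal (tendsto_upperValue hω)).limsup_eq]
      exact limsup_le_limsup (Eventually.of_forall fun n ↦ Set.indicator_le_self _ _ _)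
    · have h' (n : ℕ) : ω ∉ B n := fun hn ↦ h ⟨hn.1.1, hBτ n hn⟩
      simp only [Set.indicator_of_notMem (h' _)]
      simp

/-- A measure which has the density `Y t` on `{t < ζ}` at each deterministic time `t` has the
density `Y τ` on `{τ < ζ}` at each stopping time `τ`. -/
theorem isPriorDensityProcess_of_deterministic (hY : StronglyAdapted (filtrationPlus E x₀) Y)
    [IsFiniteMeasure P] [IsFiniteMeasure Q] (hP : ∀ᵐ ω ∂P, lifetime ω = ⊤)
    (hcad : ∀ᵐ ω ∂P, IsCadlagPath fun t ↦ Y t ω) (hnn : ∀ᵐ ω ∂P, ∀ t, 0 ≤ Y t ω)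
    (hQ : ∀ t A, MeasurableSet[filtrationPlus E x₀ t] A →
      Q (A ∩ {ω | (t : WithTop ℝ≥0) < lifetime ω}) = ∫⁻ ω in A, ENNReal.ofReal (Y t ω) ∂P) :
    IsPriorDensityProcess Y Q P := by
  refine ⟨hY, hnn.and hcad, fun τ hτ A hA ↦ ?_⟩
  have hset : (A ∩ {ω | τ ω < lifetime ω} : Set _) =ᵐ[P] (A ∩ {ω | τ ω ≠ ⊤} : Set _) := by
    filter_upwards [hP] with ω hω
    refine propext (and_congr_right fun _ ↦ ?_)
    change τ ω < lifetime ω ↔ τ ω ≠ ⊤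
    rw [hω, lt_top_iff_ne_top]
  rw [setLIntegral_congr hset]
  refine le_antisymm ?_ (lintegral_stoppedValue_le hY hcad hQ hτ hA)
  have hQP : ∀ t A, MeasurableSet[filtrationPlus E x₀ t] A → P A = 0 →
      Q (A ∩ {ω | (t : WithTop ℝ≥0) < lifetime ω}) = 0 := fun t A hA h ↦ by
    rw [hQ t A hA, setLIntegral_measure_zero _ _ h]
  have hmono : Monotone fun c ↦ A ∩ {ω | τ ω < lifetime ω} ∩ boundedAfter Y τ c := by
    intro c d hcd
    refine Set.inter_subset_inter_right _ fun ω hω ↦ ⟨hω.1, hω.2.mono fun n hn ↦ ?_⟩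
    exact hn.trans (Nat.cast_le.2 hcd)
  calc Q (A ∩ {ω | τ ω < lifetime ω})
      ≤ Q (⋃ c, A ∩ {ω | τ ω < lifetime ω} ∩ boundedAfter Y τ c) := by
        refine measure_mono_ae ?_
        filter_upwards [ae_exists_mem_boundedAfter hY hcad hQP hτ] with ω hω h
        obtain ⟨c, hc⟩ := hω h.2
        exact Set.mem_iUnion.2 ⟨c, h, hc⟩
    _ = ⨆ c, Q (A ∩ {ω | τ ω < lifetime ω} ∩ boundedAfter Y τ c) := hmono.measure_iUnion
    _ ≤ _ := iSup_le fun c ↦ measure_boundedAfter_le hY hcad hQ hτ hA c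

end

/-! ### Foretellability of the lifetime -/

section

variable {E : Type*} [TopologicalSpace E] [MeasurableSpace E] {x₀ : E}
  {P Q : Measure (PathSpace E x₀)} {Y : ℝ≥0 → PathSpace E x₀ → ℝ}

/-- A localizing time, capped at a deterministic time, keeps the mass of a local martingale. -/
lemma integral_stoppedValue_min {σ : PathSpace E x₀ → WithTop ℝ≥0}
    (hσ : IsStoppingTime (filtrationPlus E x₀) σ) (hY0 : Integrable (Y 0) P) (r : ℝ≥0)
    (hX : ∀ t, Integrable (stoppedProcess (fun i ↦ {ω | ⊥ < σ ω}.indicator (Y i)) σ t) P)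
    [IsFiniteMeasure P]
    (hmart : P[stoppedProcess (fun i ↦ {ω | ⊥ < σ ω}.indicator (Y i)) σ r |
        filtrationPlus E x₀ 0] =ᵐ[P]
      stoppedProcess (fun i ↦ {ω | ⊥ < σ ω}.indicator (Y i)) σ 0) :
    Integrable (stoppedValue Y fun ω ↦ min (r : WithTop ℝ≥0) (σ ω)) P ∧
      ∫ ω, stoppedValue Y (fun ω ↦ min (r : WithTop ℝ≥0) (σ ω)) ω ∂P = ∫ ω, Y 0 ω ∂P := by
  set X := stoppedProcess (fun i ↦ {ω | ⊥ < σ ω}.indicator (Y i)) σ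
  have hmeas : MeasurableSet {ω | ⊥ < σ ω}ᶜ :=
    ((filtrationPlus E x₀).le 0 _ (hσ.measurableSet_gt 0)).compl
  have hbot : ∀ ω, ω ∈ ({ω | ⊥ < σ ω}ᶜ : Set (PathSpace E x₀)) → σ ω = ((0 : ℝ≥0) : WithTop ℝ≥0) :=
    fun ω hω ↦ le_bot_iff.1 (not_lt.1 hω)
  -- off the event that the localizing time is positive, both sides are the initial value
  have hr : stoppedValue Y (fun ω ↦ min (r : WithTop ℝ≥0) (σ ω)) =
      X r + {ω | ⊥ < σ ω}ᶜ.indicator (Y 0) := by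
    funext ω
    by_cases h : ω ∈ {ω | ⊥ < σ ω}
    · simp only [X, stoppedProcess, stoppedValue, Pi.add_apply, Set.indicator_of_mem h,
        Set.indicator_of_notMem (Set.notMem_compl_iff.2 h), add_zero]
    · have h' := Set.mem_compl h
      simp only [X, stoppedProcess, stoppedValue, Pi.add_apply, Set.indicator_of_notMem h,
        Set.indicator_of_mem h', zero_add, hbot ω h']
      rw [min_eq_right (by exact_mod_cast zero_le)]
      rfl
  have h0 : Y 0 = X 0 + {ω | ⊥ < σ ω}ᶜ.indicator (Y 0) := by
    funext ω
    by_cases h : ω ∈ {ω | ⊥ < σ ω}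
    · simp only [X, stoppedProcess, Pi.add_apply, Set.indicator_of_mem h,
        Set.indicator_of_notMem (Set.notMem_compl_iff.2 h), add_zero]
      rw [min_eq_left (by exact_mod_cast zero_le)]
      rfl
    · simp only [X, stoppedProcess, Pi.add_apply, Set.indicator_of_notMem h,
        Set.indicator_of_mem (Set.mem_compl h), zero_add]
  have hint := hY0.indicator hmeas
  have hXX : ∫ ω, X r ω ∂P = ∫ ω, X 0 ω ∂P := by
    rw [← integral_condExp ((filtrationPlus E x₀).le 0) (f := X r)]
    exact integral_congr_ae hmart
  refine ⟨hr ▸ (hX r).add hint, ?_⟩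
  rw [hr]
  conv_rhs => rw [h0]
  rw [integral_add' (hX r) hint, integral_add' (hX 0) hint, hXX]

lemma measurableSet_stoppingTime_lt_lifetime {τ : PathSpace E x₀ → WithTop ℝ≥0}
    (hτ : IsStoppingTime (filtrationPlus E x₀) τ) : MeasurableSet {ω | τ ω < lifetime ω} := by
  have h : {ω | τ ω < lifetime ω} = ⋃ j, {ω | τ ω < dyadicTime j} ∩
      {ω | (dyadicTime j : WithTop ℝ≥0) < lifetime ω} := by
    ext ω
    simp only [Set.mem_iUnion, Set.mem_inter_iff, Set.mem_ofPred_eq]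
    refine ⟨fun hω ↦ ?_, fun ⟨j, h1, h2⟩ ↦ h1.trans h2⟩
    obtain ⟨θ, hθ⟩ := WithTop.ne_top_iff_exists.1 (ne_top_of_lt hω)
    rw [← hθ] at hω ⊢
    obtain ⟨j, hj, hj'⟩ := exists_dyadicTime_between_withTop hω
    exact ⟨j, WithTop.coe_lt_coe.2 hj, hj'⟩
  rw [h]
  exact MeasurableSet.iUnion fun j ↦ ((filtrationPlus E x₀).le _ _ (hτ.measurableSet_lt _)).inter
    ((naturalFiltration E x₀).le _ _ (measurableSet_lt_lifetime _))

/-- If `Y` is a local martingale then the localizing times, capped at deterministic times, foretell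
the lifetime: no mass is lost up to such a time, and they converge to infinity under `P`. -/
lemma lifetimeForetellable_of_isLocalMartingale [IsProbabilityMeasure P] [IsProbabilityMeasure Q]
    (hP : ∀ᵐ ω ∂P, lifetime ω = ⊤) (hY0 : Integrable (Y 0) P) (hzero : ∫ ω, Y 0 ω ∂P = 1)
    (hQP : ∀ t A, MeasurableSet[filtrationPlus E x₀ t] A → P A = 0 →
      Q (A ∩ {ω | (t : WithTop ℝ≥0) < lifetime ω}) = 0)
    (hdens : IsPriorDensityProcess Y Q P) (hloc : IsLocalMartingale Y P) :
    LifetimeForetellable Q := by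
  obtain ⟨-, -, σ, hσ, hmart⟩ := hloc
  obtain ⟨-, hnn, hformula⟩ := hdens
  have hst (n : ℕ) : IsStoppingTime (filtrationPlus E x₀)
      fun ω ↦ min (((n : ℝ≥0)) : WithTop ℝ≥0) (σ n ω) :=
    (isStoppingTime_const _ (n : ℝ≥0)).min (hσ.isStoppingTime n)
  have hlt (n : ℕ) : ∀ᵐ ω ∂Q, min ((n : ℝ≥0) : WithTop ℝ≥0) (σ n ω) < lifetime ω := by
    obtain ⟨hint, hone⟩ := integral_stoppedValue_min (hσ.isStoppingTime n) hY0 (n : ℝ≥0)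
      (hmart n).1 ((hmart n).2 0 n zero_le)
    have hmin (ω : PathSpace E x₀) : min ((n : ℝ≥0) : WithTop ℝ≥0) (σ n ω) < ⊤ :=
      (min_le_left _ _).trans_lt (WithTop.coe_lt_top _)
    have h1 := hformula _ (hst n) Set.univ MeasurableSet.univ
    have h2 : (Set.univ ∩ {ω | min ((n : ℝ≥0) : WithTop ℝ≥0) (σ n ω) < lifetime ω} : Set _) =ᵐ[P]
        (Set.univ : Set (PathSpace E x₀)) := by
      filter_upwards [hP] with ω hω
      refine propext ⟨fun _ ↦ trivial, fun _ ↦ ⟨trivial, ?_⟩⟩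
      change _ < lifetime ω
      rw [hω]
      exact hmin ω
    rw [setLIntegral_congr h2, Measure.restrict_univ, ← ofReal_integral_eq_lintegral_ofReal hint
      (hnn.mono fun ω h ↦ h.1 _), hone, hzero, ENNReal.ofReal_one, Set.univ_inter] at h1
    exact (mem_ae_iff_prob_eq_one (measurableSet_stoppingTime_lt_lifetime (hst n))).2 h1
  have hge (j : ℕ) : ∀ᵐ ω ∂Q, (dyadicTime j : WithTop ℝ≥0) < lifetime ω →
      ∀ᶠ n in atTop, (dyadicTime j : WithTop ℝ≥0) ≤ σ n ω := by
    -- the localizing times drop below `dyadicTime j` infinitely often only on a `P`-null event,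
    -- which is determined by the path up to that time
    let N : Set (PathSpace E x₀) := ⋂ m, ⋃ n, ⋃ (_ : m ≤ n), {ω | σ n ω < dyadicTime j}
    have hN : MeasurableSet[filtrationPlus E x₀ (dyadicTime j)] N :=
      MeasurableSet.iInter fun m ↦ MeasurableSet.iUnion fun n ↦ MeasurableSet.iUnion fun _ ↦
        (hσ.isStoppingTime n).measurableSet_lt _
    have hmem (ω : PathSpace E x₀) : ω ∉ N ↔
        ∀ᶠ n in atTop, (dyadicTime j : WithTop ℝ≥0) ≤ σ n ω := by
      simp only [N, Set.mem_iInter, Set.mem_iUnion, Set.mem_ofPred_eq, eventually_atTop]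
      push Not
      rfl
    have hPN : P N = 0 := by
      refine measure_mono_null (t := {ω | ¬ Tendsto (σ · ω) atTop (𝓝 ⊤)}) (fun ω hω h ↦ ?_)
        (ae_iff.1 hσ.tendsto_top)
      refine (hmem ω).2 ?_ hω
      exact (h.eventually (lt_mem_nhds (WithTop.coe_lt_top (dyadicTime j)))).mono fun n hn ↦ hn.le
    refine measure_mono_null (fun ω hω ↦ ?_) (hQP _ N hN hPN)
    have hω' : ¬ ((dyadicTime j : WithTop ℝ≥0) < lifetime ω → _) := hω
    rw [Classical.not_imp, ← hmem, not_not] at hω'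
    exact ⟨hω'.2, hω'.1⟩
  refine ⟨fun n ω ↦ min ((n : ℝ≥0) : WithTop ℝ≥0) (σ n ω), hst, hlt, ?_⟩
  filter_upwards [ae_all_iff.2 hlt, ae_all_iff.2 hge] with ω hω hω'
  refine tendsto_order.2 ⟨fun a ha ↦ ?_, fun a ha ↦ Eventually.of_forall fun n ↦ (hω n).trans ha⟩
  obtain ⟨θ, rfl⟩ := WithTop.ne_top_iff_exists.1 (ne_top_of_lt ha)
  obtain ⟨j, hj, hj'⟩ := exists_dyadicTime_between_withTop ha
  have hn : ∀ᶠ n : ℕ in atTop, dyadicTime j ≤ n := tendsto_natCast_atTop_atTop.eventually_ge_atTop _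
  filter_upwards [hω' j hj', hn] with n h1 h2
  exact (WithTop.coe_lt_coe.2 hj).trans_le (le_min (WithTop.coe_le_coe.2 h2) h1)

end

end ExitMeasure

end

theorem mainTheorem5 {E : Type*} [TopologicalSpace E] [PolishSpace E] [MeasurableSpace E]
    [BorelSpace E] (x₀ : E)
    (P : Measure (ExitMeasure.PathSpace E x₀)) [IsProbabilityMeasure P]
    (hP : ∀ᵐ ω ∂P, ExitMeasure.lifetime ω = ⊤)
    (Y : ℝ≥0 → ExitMeasure.PathSpace E x₀ → ℝ)
    (hY_super : Supermartingale Y (ExitMeasure.filtrationPlus E x₀) P)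
    (hY_cadlag : ∀ᵐ ω ∂P, ExitMeasure.IsCadlagPath fun t ↦ Y t ω)
    (hY_pos : ∀ᵐ ω ∂P, ∀ t, 0 < Y t ω)
    (hY_zero : ∫ ω, Y 0 ω ∂P = 1) :
    ∃ Q : Measure (ExitMeasure.PathSpace E x₀), IsProbabilityMeasure Q ∧
      ExitMeasure.PriorEquivalent Q P ∧
      ExitMeasure.IsPriorDensityProcess Y Q P ∧
      (ExitMeasure.IsLocalMartingale Y P → ExitMeasure.LifetimeForetellable Q) := by
  obtain ⟨Q, hQprob, hQ⟩ := (ExitMeasure.isSurvivalFamily_densityFamily hP hY_super hY_pos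
    hY_zero).exists_measure fun t A hA ↦
      ExitMeasure.tendsto_densityFamily hY_super hY_cadlag hY_pos hA
  have hQ' : ∀ t A, MeasurableSet[ExitMeasure.filtrationPlus E x₀ t] A →
      Q (A ∩ {ω | (t : WithTop ℝ≥0) < ExitMeasure.lifetime ω}) =
        ∫⁻ ω in A, ENNReal.ofReal (Y t ω) ∂P := fun t A hA ↦ by
    rw [hQ t A hA,
      ExitMeasure.densityFamily_apply t ((ExitMeasure.filtrationPlus E x₀).le t A hA)]
  have hQP : ∀ t A, MeasurableSet[ExitMeasure.filtrationPlus E x₀ t] A → P A = 0 →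
      Q (A ∩ {ω | (t : WithTop ℝ≥0) < ExitMeasure.lifetime ω}) = 0 := fun t A hA h ↦ by
    rw [hQ' t A hA, setLIntegral_measure_zero _ _ h]
  have hdens : ExitMeasure.IsPriorDensityProcess Y Q P :=
    ExitMeasure.isPriorDensityProcess_of_deterministic hY_super.stronglyAdapted hP hY_cadlag
      (hY_pos.mono fun ω h t ↦ (h t).le) hQ'
  refine ⟨Q, hQprob, ⟨fun t A hA h ↦ ?_, fun t A hA h ↦ ?_⟩, hdens,
    ExitMeasure.lifetimeForetellable_of_isLocalMartingale hP (hY_super.integrable 0) hY_zero hQP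
      hdens⟩
  · have hA' := hA.inter (ExitMeasure.measurableSet_lt_lifetime t)
    have := hQP t _ (ExitMeasure.naturalFiltration_le_filtrationPlus t _ hA') h
    rwa [Set.inter_assoc, Set.inter_self] at this
  · -- the density is strictly positive
    rw [hQ' t A (ExitMeasure.naturalFiltration_le_filtrationPlus t A hA)] at h
    have hmeas : Measurable (Y t) := ((hY_super.stronglyMeasurable t).mono
      ((ExitMeasure.filtrationPlus E x₀).le t)).measurable
    rw [lintegral_eq_zero_iff hmeas.ennreal_ofReal] at h
    refine measure_mono_null Set.inter_subset_left ?_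
    rw [← Measure.restrict_eq_zero, ← ae_eq_bot, ← eventually_false_iff_eq_bot]
    filter_upwards [h, ae_restrict_of_ae (s := A) hY_pos] with ω h1 h2
    exact absurd (ENNReal.ofReal_eq_zero.1 h1) (not_le.2 (h2 t))
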